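/- Let $L=\{+,-,1,R_r : r\in\mathbb{Q}^+\}$, where $+$ is a binary and $-$ a unary function symbol, $1$ is a constant and each $R_r$ is a binary relation symbol. View $\mathbb{R}$ as an $L$-structure with the usual $+,-,1$ and with $R_r(x,y)$ holding if and only if $0\le y-x\le r$, and let $T=\mathrm{Th}(\mathbb{R},+,-,1,R_r)_{r\in\mathbb{Q}^+}$. Let $\mathfrak{C}\prec\mathfrak{C}'$ be models of $T$ such that $\mathfrak{C}$ is $\kappa$-saturated for a strong limit cardinal $\kappa>\aleph_0$, and $\mathfrak{C}'$ is $\kappa'$-saturated and strongly $\kappa'$-homogeneous for a strong limit cardinal $\kappa'>|\mathfrak{C}|$. A set is called $\mathfrak{C}$-small if its cardinality is less than $\kappa$. Write $S_r(x,y)$ for $R_r(x,y)\vee R_r(y,x)$ and $0$ for $1+(-1)$. Put $x\,E\,y$ if $S_r(x,y)$ holds for all $r\in\mathbb{Q}^+$ (that is, $x$ and $y$ lie in the same coset of the group of infinitesimals of $\mathfrak{C}'$). A positive infinitesimal is an element $a\neq 0$ such that $R_r(0,a)$ holds for all $r\in\mathbb{Q}^+$. For a set $A$ of positive infinitesimals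 put $x\,E_A\,y$ if $|x-y|\le\frac1n a$ for all $a\in A$ and all integers $n\ge 1$, which means that $R_1(n(x-y),a)$ and $R_1(n(y-x),a)$ hold for all such $a$ and $n$. Then there is exactly one complete type $p\in S_1(\mathfrak{C})$ containing all the formulas $\neg R_r(x,c)\wedge\neg R_r(c,x)$ with $c\in\mathfrak{C}$ and $r\in\mathbb{Q}^+$. Let $p(\mathfrak{C}')$ be the set of its realizations in $\mathfrak{C}'$. A binary relation $F$ on $p(\mathfrak{C}')$ is said to be relatively type-definable over $B\subseteq\mathfrak{C}$ if there is a set $\pi(x,y)$ of $L$-formulas with parameters from $B$ such that, for all $x,y\in p(\mathfrak{C}')$, $F(x,y)$ holds if and only if $(x,y)$ satisfies every formula of $\pi$ in $\mathfrak{C}'$. The equivalence relations on $p(\mathfrak{C}')$ which are relatively type-definable over some $\mathfrak{C}$-small subset of $\mathfrak{C}$ are exactly the following relations on $p(\mathfrak{C}')$: 1. the total relation; 2. equality; 3. $E$ (restricted to $p(\mathfrak{C}')$); 4. $E_c$ for $c\in\mathfrak{C}$, where $x\,E_c\,y$ if and only if $x=y$ or $x+y=c$; 5. $E_c^\mu$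 for $c\in\mathfrak{C}$, where $x\,E_c^\mu\,y$ if and only if $x\,E\,y$ or $(x+y)\,E\,c$; 6. $E_A$ (restricted to $p(\mathfrak{C}')$) for a non-empty $\mathfrak{C}$-small set $A$ of positive infinitesimals of $\mathfrak{C}$; 7. $E_{A,c}$ for $c\in\mathfrak{C}$ and a non-empty $\mathfrak{C}$-small set $A$ of positive infinitesimals of $\mathfrak{C}$, where $x\,E_{A,c}\,y$ if and only if $x\,E_A\,y$ or $(x+y)\,E_A\,c$. -/

import Mathlib

open FirstOrder Cardinal

universe u

namespace LocalOrder

section ModelTheory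

open FirstOrder.Language

variable (L : FirstOrder.Language.{0, 0}) (M : Type u) [L.Structure M]

/-- `M` is `κ`-saturated: every set of formulas in one variable with fewer than `κ` parameters from
`M` which is finitely satisfiable in `M` is realized in `M`. -/
def IsSaturated (κ : Cardinal.{u}) : Prop :=
  ∀ A : Set M, #A < κ → ∀ Γ : Set (L[[A]].Formula (Fin 1)),
    (∀ s : Finset (L[[A]].Formula (Fin 1)), (∀ φ ∈ s, φ ∈ Γ) →
      ∃ x : M, ∀ φ ∈ s, φ.Realize (fun _ => x)) →
    ∃ x : M, ∀ φ ∈ Γ, φ.Realize (fun _ => x)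

/-- `M` is strongly `κ`-homogeneous: every partial elementary map with domain of size less than `κ`
extends to an automorphism of `M`. -/
def IsStronglyHomogeneous (κ : Cardinal.{u}) : Prop :=
  ∀ A : Set M, #A < κ → ∀ f : A → M,
    (∀ φ : L.Formula A, φ.Realize (fun a => (a : M)) ↔ φ.Realize f) →
    ∃ σ : M ≃[L] M, ∀ a : A, σ a = f a

variable {M}

/-- The complete `1`-types over a set of parameters `A` in `M`. When `A` is the universe of an
elementary substructure `C` of `M`, this is the space of complete `1`-types over `C`. -/
abbrev TypeOver (A : Set M) : Type u :=
  (L[[A]].completeTheory M).CompleteType (Fin 1)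

variable {L}

/-- The formula `φ(x)` belongs to the type `p(x)`. -/
def TypeOver.Contains {A : Set M} (p : TypeOver L A) (φ : L[[A]].Formula (Fin 1)) : Prop :=
  Formula.equivSentence φ ∈ p

/-- The set of realizations of the type `p` in `M`. -/
def TypeOver.realizations {A : Set M} (p : TypeOver L A) : Set M :=
  {x | ∀ φ : L[[A]].Formula (Fin 1), p.Contains φ → φ.Realize (fun _ => x)}

/-- The relation `F` on the set `X` is the intersection of `X ^ 2` with a set which is
type-definable over some subset of `C` of size less than `κ`. -/
def IsRelTypeDefinable (κ : Cardinal.{u}) (C : Set M) {X : Set M} (F : X → X → Prop) : Prop :=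
  ∃ B : Set M, B ⊆ C ∧ #B < κ ∧ ∃ π : Set (L[[B]].Formula (Fin 2)),
    ∀ x y : X, F x y ↔ ∀ φ ∈ π, φ.Realize ![(x : M), (y : M)]

end ModelTheory

/-- Positive rational numbers. -/
abbrev PosRat : Type := {r : ℚ // 0 < r}

/-- Function symbols `+`, `-` (unary) and the constant symbol `1`. -/
inductive Func : ℕ → Type
  | one : Func 0
  | neg : Func 1
  | add : Func 2

/-- Binary relation symbols `R_r`, one for every positive rational `r`. -/
inductive Rel : ℕ → Type
  | R (r : PosRat) : Rel 2

/-- The language `{+, -, 1, R_r : r ∈ ℚ⁺}`. -/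
def lang : FirstOrder.Language.{0, 0} := ⟨Func, Rel⟩

def oneSymb : lang.Functions 0 := Func.one

def negSymb : lang.Functions 1 := Func.neg

def addSymb : lang.Functions 2 := Func.add

def relSymb (r : PosRat) : lang.Relations 2 := Rel.R r

/-- The real numbers; `R_r x y` holds if and only if `0 ≤ y - x ≤ r`. -/
instance : lang.Structure ℝ where
  funMap {_} f := match f with
    | Func.one => fun _ => 1
    | Func.neg => fun v => -v 0
    | Func.add => fun v => v 0 + v 1
  RelMap {_} R := match R with
    | Rel.R r => fun v => 0 ≤ v 1 - v 0 ∧ v 1 - v 0 ≤ ((r : ℚ) : ℝ)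

/-- The theory of `(ℝ, +, -, 1, R_r)`. -/
def theory : lang.Theory := lang.completeTheory ℝ

section Structure

variable {M : Type u} [lang.Structure M]

def one : M := FirstOrder.Language.Structure.funMap (M := M) oneSymb ![]

def neg (x : M) : M := FirstOrder.Language.Structure.funMap negSymb ![x]

def add (x y : M) : M := FirstOrder.Language.Structure.funMap addSymb ![x, y]

def R (r : PosRat) (x y : M) : Prop := FirstOrder.Language.Structure.RelMap (relSymb r) ![x, y]

def sub (x y : M) : M := add x (neg y)

def zero : M := sub one one

/-- The multiple `n x = x + ⋯ + x`. -/
def nmul : ℕ → M → M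
  | 0, _ => zero
  | n + 1, x => add (nmul n x) x

/-- `S_r(x, y)`, that is `|x - y| ≤ r`. -/
def S (r : PosRat) (x y : M) : Prop := R r x y ∨ R r y x

/-- `x` and `y` lie in the same coset of the group `μ` of infinitesimals. -/
def relE (x y : M) : Prop := ∀ r : PosRat, S r x y

/-- `a` is a positive infinitesimal: `a ≠ 0` and `0 ≤ a ≤ r` for every positive rational `r`. -/
def IsPosInfinitesimal (a : M) : Prop := a ≠ zero ∧ ∀ r : PosRat, R r zero a

/-- For a set `A` of positive infinitesimals: `|x - y| ≤ a / n` for all `a ∈ A` and all positive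
integers `n`. The inequality is expressed in the language by `0 ≤ a - n(x - y) ≤ 1` and
`0 ≤ a - n(y - x) ≤ 1`. -/
def relEA (A : Set M) (x y : M) : Prop :=
  ∀ a ∈ A, ∀ n : ℕ, 0 < n → R 1 (nmul n (sub x y)) a ∧ R 1 (nmul n (sub y x)) a

def relEc (c x y : M) : Prop := x = y ∨ add x y = c

def relEcμ (c x y : M) : Prop := relE x y ∨ relE (add x y) c

def relEAc (A : Set M) (c x y : M) : Prop := relEA A x y ∨ relEA A (add x y) c

/-- The formula `¬ R_r(x, c) ∧ ¬ R_r(c, x)` in the variable `x` with parameter `c`. -/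
def unrelatedFormula {C : Set M} (r : PosRat) (c : C) :
    (lang.withConstants C).Formula (Fin 1) :=
  let R' : (lang.withConstants C).Relations 2 :=
    (lang.lhomWithConstants C).onRelation (relSymb r)
  let x : (lang.withConstants C).Term (Fin 1) := FirstOrder.Language.Term.var 0
  let k : (lang.withConstants C).Term (Fin 1) := (lang.con c).term
  (R'.formula₂ x k).not ⊓ (R'.formula₂ k x).not

/-- The type `p` says that its realizations are unrelated to every element of `C`. -/
def SaysUnrelated {C : Set M} (p : TypeOver lang C) : Prop :=
  ∀ (r : PosRat) (c : C), p.Contains (unrelatedFormula r c)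

end Structure

end LocalOrder

/-! Order a model by `x ≤ y` when some `R_r(x, y)` holds. The model becomes a partially ordered
`ℚ`-vector space in which two elements are comparable ("near") exactly when their difference is
bounded, and `R_r(x, y)` means `x ≤ y ≤ x + r • 1` (`R_iff`). By back and forth, small `ℚ`-linear
partial isomorphisms of a saturated model preserve all formulas (`IsSaturated.realize_iff`). An
element far from a subspace satisfies no order relation with it, so all elements far from `C` have
one type, namely `p`.

Let `F` be defined over a small subspace `U` of `C`, and let `W` be the space of elements near `C`,
so that `p` is realized exactly outside `W`. If `F` relates `x` to some `y` outside `W + ℚx`, then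
it relates all such pairs and is total. Otherwise related elements satisfy `y = q x + d` with `d ∈
W`. Iterating this relation and passing to a limit by saturation would again produce an independent
related pair unless `|q| = 1`, and, for `q = 1`, unless `d` is infinitesimal. So `F` is given by a
group `H` of infinitesimal translations, possibly together with a reflection `x ↦ -x + c`.

Membership in `H` depends only on the cut over `U`. Comparing cuts of limits of elements of `H`
shows that `H` is convex (`mem_H_of_le`) and that nothing but elements of `U` can bound it
(`mem_H_of_forall_lt`). Hence `H` is zero, or all infinitesimals, or the infinitesimals infinitely
smaller than every positive infinitesimal of `U` outside `H`. The constant `c` can be taken in `C`,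
since only its cut over `U` matters and `C` is saturated (`exists_same_cut`). -/

namespace LocalOrder

open FirstOrder.Language Filter

/-! ### Terms and atomic formulas of the language -/

section Terms

variable {α : Type*}

/-- The term `s + t`. -/
def addTerm (s t : lang.Term α) : lang.Term α := Functions.apply₂ addSymb s t

/-- The term `-t`. -/
def negTerm (t : lang.Term α) : lang.Term α := Functions.apply₁ negSymb t

/-- The term `1`. -/
def oneTerm : lang.Term α := Constants.term oneSymb

/-- The term `1 + (-1)`. -/
def zeroTerm : lang.Term α := addTerm oneTerm (negTerm oneTerm)

/-- The term `n t`. -/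
def nmulTerm : ℕ → lang.Term α → lang.Term α
  | 0, _ => zeroTerm
  | n + 1, t => addTerm (nmulTerm n t) t

variable {M : Type u} [lang.Structure M] (v : α → M)

@[simp] lemma realize_addTerm (s t : lang.Term α) :
    (addTerm s t).realize v = add (s.realize v) (t.realize v) :=
  Term.realize_functions_apply₂

@[simp] lemma realize_negTerm (t : lang.Term α) : (negTerm t).realize v = neg (t.realize v) :=
  Term.realize_functions_apply₁

@[simp] lemma realize_oneTerm : (oneTerm : lang.Term α).realize v = one := by
  simp only [oneTerm, Constants.term, Term.realize, one]
  congr 1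
  exact Subsingleton.elim _ _

@[simp] lemma realize_zeroTerm : (zeroTerm : lang.Term α).realize v = zero := by
  simp [zeroTerm, zero, sub]

@[simp] lemma realize_nmulTerm (n : ℕ) (t : lang.Term α) :
    (nmulTerm n t).realize v = nmul n (t.realize v) := by
  induction n with
  | zero => simp [nmulTerm, nmul]
  | succ n ih => simp [nmulTerm, nmul, ih]

/-- The formula `R_r(s, t)`. -/
def relFormula {n : ℕ} (r : PosRat) (s t : lang.Term (α ⊕ Fin n)) : lang.BoundedFormula α n :=
  (relSymb r).boundedFormula₂ s t

@[simp] lemma realize_relFormula {n : ℕ} (xs : Fin n → M) (r : PosRat)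
    (s t : lang.Term (α ⊕ Fin n)) : (relFormula r s t).Realize v xs ↔
      R r (s.realize (Sum.elim v xs)) (t.realize (Sum.elim v xs)) :=
  BoundedFormula.realize_rel₂

end Terms

section Real

@[simp] lemma add_real (x y : ℝ) : add x y = x + y := rfl
@[simp] lemma neg_real (x : ℝ) : neg x = -x := rfl
@[simp] lemma one_real : (one : ℝ) = 1 := rfl
@[simp] lemma zero_real : (zero : ℝ) = 0 := by simp [zero, sub]
@[simp] lemma R_real (r : PosRat) (x y : ℝ) : R r x y ↔ 0 ≤ y - x ∧ y - x ≤ (r : ℚ) := Iff.rfl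
@[simp] lemma nmul_real (n : ℕ) (x : ℝ) : nmul n x = n * x := by
  induction n with
  | zero => simp [nmul]
  | succ n ih => simp [nmul, ih]; ring

end Real

/-! ### First-order facts transferred from the reals -/

section Transfer

variable {M : Type u} [lang.Structure M]

lemma transfer (hM : M ⊨ theory) {n : ℕ} (φ : lang.BoundedFormula Empty n)
    (h : ∀ (v : Empty → ℝ) (xs : Fin n → ℝ), φ.Realize v xs) (v : Empty → M) (xs : Fin n → M) :
    φ.Realize v xs := by
  have h1 : φ.alls ∈ theory := by
    change ℝ ⊨ φ.alls
    exact BoundedFormula.realize_alls.2 (h _)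
  rw [Subsingleton.elim v default]
  exact BoundedFormula.realize_alls.1 (hM.realize_of_mem _ h1) xs

variable [hM : M ⊨ theory]

lemma raw_add_assoc (x y z : M) : add (add x y) z = add x (add y z) := by
  simpa using transfer hM (n := 3)
    (addTerm (addTerm (&0) (&1)) (&2) =' addTerm (&0) (addTerm (&1) (&2)))
    (fun v xs => by simp [add_assoc]) Empty.elim ![x, y, z]

lemma raw_add_comm (x y : M) : add x y = add y x := by
  simpa using transfer hM (n := 2) (addTerm (&0) (&1) =' addTerm (&1) (&0))
    (fun v xs => by simp [add_comm]) Empty.elim ![x, y]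

lemma raw_add_zero (x : M) : add x zero = x := by
  simpa using transfer hM (n := 1) (addTerm (&0) zeroTerm =' (&0))
    (fun v xs => by simp) Empty.elim ![x]

lemma raw_neg_add (x : M) : add (neg x) x = zero := by
  simpa using transfer hM (n := 1) (addTerm (negTerm (&0)) (&0) =' zeroTerm)
    (fun v xs => by simp) Empty.elim ![x]

lemma raw_torsionFree (n : ℕ) (hn : n ≠ 0) (x y : M) (h : nmul n x = nmul n y) : x = y := by
  have := transfer hM (n := 2) ((nmulTerm n (&0) =' nmulTerm n (&1)).imp ((&0) =' (&1)))
    (fun v xs => by simp [hn]) Empty.elim ![x, y]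
  simp at this
  exact this h

lemma raw_divisible (n : ℕ) (hn : n ≠ 0) (x : M) : ∃ y : M, nmul n y = x := by
  have := transfer hM (n := 1) (∃' (nmulTerm n (&1) =' (&0)))
    (fun v xs => by
      simp only [BoundedFormula.realize_ex, BoundedFormula.realize_bdEqual, realize_nmulTerm]
      refine ⟨xs 0 / n, ?_⟩
      have : (n : ℝ) ≠ 0 := by exact_mod_cast hn
      simp [Fin.snoc]
      field_simp) Empty.elim ![x]
  simpa [Fin.snoc] using this

lemma raw_R_iff (r : PosRat) (x y : M) : R r x y ↔ R r zero (sub y x) := by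
  have := transfer hM (n := 2)
    ((relFormula r (&0) (&1)).iff
      (relFormula r zeroTerm (addTerm (&1) (negTerm (&0)))))
    (fun v xs => by simp [← sub_eq_add_neg]) Empty.elim ![x, y]
  simpa [sub] using this

lemma raw_R_add (r s t : PosRat) (h : t.1 = r.1 + s.1) (x y : M) (hx : R r zero x)
    (hy : R s zero y) : R t zero (add x y) := by
  have := transfer hM (n := 2)
    ((relFormula r zeroTerm (&0)).imp
      ((relFormula s zeroTerm (&1)).imp
        (relFormula t zeroTerm (addTerm (&0) (&1)))))
    (fun v xs => by
      simp only [BoundedFormula.realize_imp, realize_relFormula, realize_zeroTerm, realize_addTerm,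
        R_real, h, zero_real, add_real]
      push_cast
      rintro ⟨h1, h2⟩ ⟨h3, h4⟩
      constructor <;> linarith) Empty.elim ![x, y]
  simp at this
  exact this hx hy

lemma raw_R_antisymm (r s : PosRat) (x : M) (hx : R r zero x) (hy : R s zero (neg x)) :
    x = zero := by
  have := transfer hM (n := 1)
    ((relFormula r zeroTerm (&0)).imp
      ((relFormula s zeroTerm (negTerm (&0))).imp ((&0) =' zeroTerm)))
    (fun v xs => by
      simp only [BoundedFormula.realize_imp, realize_relFormula, realize_zeroTerm, realize_negTerm,
        R_real, BoundedFormula.realize_bdEqual, zero_real, neg_real]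
      rintro ⟨h1, h2⟩ ⟨h3, h4⟩
      linarith) Empty.elim ![x]
  simp at this
  exact this hx hy

lemma raw_R_total (r s : PosRat) (x y : M) (hx : R r zero x) (hy : R s zero y) :
    R r zero (sub x y) ∨ R s zero (sub y x) := by
  have := transfer hM (n := 2)
    ((relFormula r zeroTerm (&0)).imp
      ((relFormula s zeroTerm (&1)).imp
        ((relFormula r zeroTerm (addTerm (&0) (negTerm (&1)))) ⊔
          (relFormula s zeroTerm (addTerm (&1) (negTerm (&0)))))))
    (fun v xs => by
      simp only [BoundedFormula.realize_imp, realize_relFormula, realize_zeroTerm, realize_addTerm,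
        R_real, BoundedFormula.realize_sup, zero_real, add_real, realize_negTerm, neg_real,
        Term.realize_var, Sum.elim_inr, Function.comp_apply]
      rintro ⟨h1, h2⟩ ⟨h3, h4⟩
      rcases le_total (xs 1) (xs 0) with h | h
      · left; constructor <;> linarith
      · right; constructor <;> linarith) Empty.elim ![x, y]
  simp at this
  exact this hx hy

lemma raw_R_zero (r : PosRat) : R r (zero : M) zero := by
  have := transfer hM (n := 0) (relFormula r zeroTerm zeroTerm)
    (fun v xs => by simp [r.2.le]) Empty.elim ![]
  simpa using this

lemma raw_R_one : R (1 : PosRat) (zero : M) one := by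
  have := transfer hM (n := 0) (relFormula 1 zeroTerm oneTerm)
    (fun v xs => by simp) Empty.elim ![]
  simpa using this

lemma raw_R_of_nmul (r : PosRat) (n : ℕ) (hn : n ≠ 0) (x : M) (hx : R r zero (nmul n x)) :
    R r zero x := by
  have := transfer hM (n := 1)
    ((relFormula r zeroTerm (nmulTerm n (&0))).imp
      (relFormula r zeroTerm (&0)))
    (fun v xs => by
      simp only [BoundedFormula.realize_imp, realize_relFormula, realize_zeroTerm, realize_nmulTerm,
        R_real, zero_real, nmul_real]
      have : (1 : ℝ) ≤ n := by exact_mod_cast Nat.one_le_iff_ne_zero.2 hn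
      rintro ⟨h1, h2⟩
      constructor <;> nlinarith) Empty.elim ![x]
  simp at this
  exact this hx

/-- With `r = p / q`, the bound `x ≤ r` becomes the integral inequality `0 ≤ p • 1 - q • x`. This
and the next lemma are what reduces every `R_r` to the order and the constant `1`. -/
lemma raw_R_bound (r : PosRat) (p q : ℕ) (hp : (p : ℚ) = r.1 * q) (s : PosRat) (hs : s.1 = p)
    (x : M) (hx : R r zero x) : R s zero (sub (nmul p one) (nmul q x)) := by
  have := transfer hM (n := 1)
    ((relFormula r zeroTerm (&0)).imp
      (relFormula s zeroTerm
        (addTerm (nmulTerm p oneTerm) (negTerm (nmulTerm q (&0))))))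
    (fun v xs => by
      have hp' : (p : ℝ) = (r.1 : ℝ) * q := by exact_mod_cast hp
      simp only [BoundedFormula.realize_imp, realize_relFormula, realize_zeroTerm, realize_nmulTerm,
        R_real, zero_real, nmul_real, realize_addTerm, realize_negTerm, add_real, neg_real,
        realize_oneTerm, one_real, hs]
      push_cast
      have hq : (0 : ℝ) ≤ q := q.cast_nonneg
      rintro ⟨h1, h2⟩
      constructor <;> nlinarith) Empty.elim ![x]
  simp at this
  exact this hx

lemma raw_R_of_bound (r : PosRat) (p q : ℕ) (hq : q ≠ 0) (hp : (p : ℚ) = r.1 * q) (s t : PosRat)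
    (x : M) (hx : R s zero x) (hy : R t zero (sub (nmul p one) (nmul q x))) : R r zero x := by
  have := transfer hM (n := 1)
    ((relFormula s zeroTerm (&0)).imp
      ((relFormula t zeroTerm
        (addTerm (nmulTerm p oneTerm) (negTerm (nmulTerm q (&0))))).imp
          (relFormula r zeroTerm (&0))))
    (fun v xs => by
      have hp' : (p : ℝ) = (r.1 : ℝ) * q := by exact_mod_cast hp
      simp only [BoundedFormula.realize_imp, realize_relFormula, realize_zeroTerm, realize_nmulTerm,
        R_real, zero_real, nmul_real, realize_addTerm, realize_negTerm, add_real, neg_real,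
        realize_oneTerm, one_real]
      have hq : (0 : ℝ) < q := by exact_mod_cast Nat.pos_of_ne_zero hq
      rintro ⟨h1, h2⟩ ⟨h3, h4⟩
      refine ⟨h1, le_of_mul_le_mul_right ?_ hq⟩
      nlinarith) Empty.elim ![x]
  simp at this
  exact this hx hy

end Transfer

/-! ### Models as partially ordered rational vector spaces -/

section Group

variable {M : Type u} [lang.Structure M] [hM : M ⊨ theory]

/-- A model of `theory` is an abelian group. -/
noncomputable instance modelAddCommGroup : AddCommGroup M where
  add := add
  zero := zero
  neg := neg
  sub := sub
  add_assoc := raw_add_assoc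
  add_comm := raw_add_comm
  add_zero := raw_add_zero
  zero_add x := (raw_add_comm _ _).trans (raw_add_zero x)
  neg_add_cancel := raw_neg_add
  -- With this choice the multiples in the statement are definitionally the module multiples.
  nsmul := nmul
  zsmul := @zsmulRec M ⟨zero⟩ ⟨add⟩ ⟨neg⟩ (@nsmulRec M ⟨zero⟩ ⟨add⟩)

lemma add_eq (x y : M) : add x y = x + y := rfl
lemma neg_eq (x : M) : neg x = -x := rfl
lemma sub_eq (x y : M) : sub x y = x - y := rfl
lemma zero_eq : (zero : M) = 0 := rfl
lemma nmul_eq (n : ℕ) (x : M) : nmul n x = n • x := rfl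

instance : IsAddTorsionFree M where
  nsmul_right_injective n hn x y h := raw_torsionFree n hn x y h

/-- Scalar multiplication by rationals. -/
noncomputable instance modelSMul : SMul ℚ M :=
  ⟨fun q x => (raw_divisible q.den q.den_nz (q.num • x)).choose⟩

/-- Any fraction `n / d` representing `q` may be used to compute `q • x`, so the module axioms
reduce to identities between cross-multiplied integers. -/
lemma smul_eq_iff (q : ℚ) (n : ℤ) (d : ℕ) (hd : d ≠ 0) (h : q * d = n) (x y : M) :
    q • x = y ↔ d • y = n • x := by
  have h0 : q.den • (q • x) = q.num • x :=
    (raw_divisible q.den q.den_nz (q.num • x)).choose_spec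
  have h1 : (d : ℤ) * q.num = q.den * n := by
    have : (d : ℚ) * q.num = q.den * n := by
      rw [← h, ← Rat.mul_den_eq_num q]; ring
    exact_mod_cast this
  have h2 : d • (q.den • (q • x)) = q.den • (n • x) := by
    rw [h0, ← natCast_zsmul, ← natCast_zsmul, smul_smul, smul_smul, h1]
  constructor
  · rintro rfl
    refine nsmul_right_injective q.den_nz ?_
    simp only
    rw [← h2, smul_comm]
  · intro h3
    refine nsmul_right_injective q.den_nz (nsmul_right_injective hd ?_)
    simp only
    rw [h2, smul_comm d, h3]

lemma den_smul (q : ℚ) (x : M) : q.den • (q • x) = q.num • x :=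
  (smul_eq_iff q q.num q.den q.den_nz q.mul_den_eq_num x _).1 rfl

noncomputable instance modelModule : Module ℚ M where
  one_smul x := (smul_eq_iff 1 1 1 one_ne_zero (by simp) x x).2 (by simp)
  mul_smul p q x := by
    refine (smul_eq_iff _ (p.num * q.num) (p.den * q.den) (by simp) ?_ _ _).2 ?_
    · push_cast
      rw [← p.mul_den_eq_num, ← q.mul_den_eq_num]; ring
    · rw [mul_comm, mul_smul, den_smul, mul_smul, ← den_smul q, smul_comm]
  smul_zero q := (smul_eq_iff q q.num q.den q.den_nz q.mul_den_eq_num _ _).2 (by simp)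
  smul_add q x y := (smul_eq_iff q q.num q.den q.den_nz q.mul_den_eq_num _ _).2 (by
    simp [den_smul])
  add_smul p q x := by
    refine (smul_eq_iff _ (p.num * q.den + q.num * p.den) (p.den * q.den) (by simp) ?_ _ _).2 ?_
    · push_cast
      rw [← p.mul_den_eq_num, ← q.mul_den_eq_num]; ring
    · rw [smul_add, mul_comm, mul_smul, den_smul, mul_comm, mul_smul, den_smul, add_smul,
        mul_comm, mul_smul, mul_comm q.num, mul_smul, natCast_zsmul, natCast_zsmul]
  zero_smul x := (smul_eq_iff 0 0 1 one_ne_zero (by simp) x 0).2 (by simp)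

/-- A model of `theory` is partially ordered; the comparability classes are the cosets of the
group of bounded elements. -/
instance modelPartialOrder : PartialOrder M where
  le x y := ∃ r, R r x y
  le_refl x := ⟨1, (raw_R_iff _ _ _).2 (by
    rw [sub_eq, sub_self]; exact raw_R_zero 1)⟩
  le_trans x y z := by
    rintro ⟨r, hr⟩ ⟨s, hs⟩
    refine ⟨⟨r.1 + s.1, add_pos r.2 s.2⟩, ?_⟩
    rw [raw_R_iff] at *
    have := raw_R_add r s ⟨r.1 + s.1, add_pos r.2 s.2⟩ rfl _ _ hr hs
    have e : add (sub y x) (sub z y) = sub z x := by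
      simp only [add_eq, sub_eq]; abel
    rwa [e] at this
  le_antisymm x y := by
    rintro ⟨r, hr⟩ ⟨s, hs⟩
    rw [raw_R_iff] at *
    have := raw_R_antisymm r s _ hr (by rwa [neg_eq, sub_eq, neg_sub])
    exact (sub_eq_zero.1 this).symm

lemma le_iff_exists_R (x y : M) : x ≤ y ↔ ∃ r, R r x y := Iff.rfl

instance : IsOrderedAddMonoid M where
  add_le_add_left x y h z := by
    obtain ⟨r, hr⟩ := h
    refine ⟨r, ?_⟩
    rw [raw_R_iff] at *
    rwa [sub_eq, add_sub_add_right_eq_sub]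

lemma nonneg_of_nsmul {n : ℕ} (hn : n ≠ 0) {x : M} (h : 0 ≤ n • x) : 0 ≤ x := by
  obtain ⟨r, hr⟩ := h
  exact ⟨r, raw_R_of_nmul r n hn x hr⟩

instance : IsStrictOrderedModule ℚ M := by
  have key : ∀ (q : ℚ) (x : M), 0 ≤ q → 0 ≤ x → 0 ≤ q • x := by
    intro q x hq hx
    refine nonneg_of_nsmul q.den_nz ?_
    rw [den_smul]
    obtain ⟨n, hn⟩ := Int.eq_ofNat_of_zero_le (Rat.num_nonneg.2 hq)
    rw [hn, natCast_zsmul]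
    exact nsmul_nonneg hx n
  have : IsOrderedModule ℚ M :=
    { smul_le_smul_of_nonneg_left := fun q hq x y h => by
        rw [← sub_nonneg] at h ⊢
        rw [← smul_sub]
        exact key _ _ hq h
      smul_le_smul_of_nonneg_right := fun x hx p q h => by
        rw [← sub_nonneg] at h ⊢
        rw [← sub_smul]
        exact key _ _ h hx }
  exact {
    smul_lt_smul_of_pos_left := fun q hq x y h =>
      lt_of_le_of_ne (smul_le_smul_of_nonneg_left h.le hq.le)
        (fun h' => h.ne (smul_right_injective M hq.ne' h'))
    smul_lt_smul_of_pos_right := fun x hx p q h =>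
      lt_of_le_of_ne (smul_le_smul_of_nonneg_right h.le hx.le)
        (fun h' => by
          rw [← sub_eq_zero, ← sub_smul, smul_eq_zero] at h'
          rcases h' with h' | h'
          · exact h.ne (sub_eq_zero.1 h')
          · exact hx.ne' h') }

lemma smul_nonneg_iff {q : ℚ} (hq : 0 < q) {x : M} : 0 ≤ q • x ↔ 0 ≤ x :=
  ⟨fun h => le_of_smul_le_smul_left (by rwa [smul_zero]) hq, smul_nonneg hq.le⟩

lemma R_iff (r : PosRat) (x y : M) : R r x y ↔ x ≤ y ∧ y ≤ x + r.1 • one := by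
  have hd : (r.1.num.toNat : ℤ) = r.1.num := Int.toNat_of_nonneg (Rat.num_nonneg.2 r.2.le)
  have hp : (r.1.num.toNat : ℚ) = r.1 * r.1.den := by
    rw [Rat.mul_den_eq_num]; exact_mod_cast hd
  have e : ∀ z : M, sub (nmul r.1.num.toNat one) (nmul r.1.den z) = r.1.den • (r.1 • one - z) := by
    intro z
    rw [smul_sub, den_smul, ← hd, natCast_zsmul]; rfl
  rw [raw_R_iff]
  constructor
  · intro h
    refine ⟨sub_nonneg.1 ⟨r, h⟩, ?_⟩
    have h1 := raw_R_bound r r.1.num.toNat r.1.den hp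
      ⟨r.1.num.toNat, by rw [hp]; exact mul_pos r.2 (by exact_mod_cast r.1.den_pos)⟩ rfl _ h
    rw [e] at h1
    have := nonneg_of_nsmul r.1.den_nz ⟨_, h1⟩
    rw [sub_eq, sub_nonneg, sub_le_iff_le_add'] at this
    exact this
  · rintro ⟨h1, h2⟩
    obtain ⟨s, hs⟩ := sub_nonneg.2 h1
    rw [← sub_le_iff_le_add', ← sub_nonneg] at h2
    obtain ⟨t, ht⟩ := nsmul_nonneg h2 r.1.den
    exact raw_R_of_bound r r.1.num.toNat r.1.den r.1.den_nz hp s t _ hs (by rw [e]; exact ht)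

lemma one_nonneg : (0 : M) ≤ one := ⟨1, raw_R_one⟩

lemma le_iff_exists (x y : M) : x ≤ y ↔ ∃ r : PosRat, x ≤ y ∧ y ≤ x + r.1 • one := by
  rw [le_iff_exists_R]
  exact exists_congr fun r => R_iff r x y

lemma one_elt_ne_zero : (one : M) ≠ 0 := by
  simpa [zero_eq] using transfer hM (n := 0) (oneTerm =' zeroTerm).not (fun v xs => by simp)
    Empty.elim ![]

lemma one_elt_pos : (0 : M) < one := lt_of_le_of_ne one_nonneg one_elt_ne_zero.symm

lemma exists_nat_bound {x y : M} (h : x ≤ y) : ∃ n : ℕ, 0 < n ∧ y ≤ x + n • one := by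
  obtain ⟨r, -, h2⟩ := (le_iff_exists x y).1 h
  obtain ⟨n, hn⟩ := exists_nat_gt r.1
  refine ⟨n, by exact_mod_cast r.2.trans hn, h2.trans ?_⟩
  rw [← Nat.cast_smul_eq_nsmul ℚ]
  exact add_le_add_right (smul_le_smul_of_nonneg_right hn.le one_nonneg) x

end Group

/-! ### Comparability and bounded elements -/

section Near

variable {M : Type u} [lang.Structure M] [hM : M ⊨ theory]

/-- Two elements are near each other if they are comparable, i.e. their difference is bounded. -/
def Near (x y : M) : Prop := x ≤ y ∨ y ≤ x

lemma Near.symm {x y : M} (h : Near x y) : Near y x := Or.symm h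

lemma Near.refl (x : M) : Near x x := Or.inl le_rfl

lemma near_iff_exists_S {x y : M} : Near x y ↔ ∃ r, S r x y := by
  simp only [S, exists_or]
  rfl

lemma nonneg_total {x y : M} (hx : 0 ≤ x) (hy : 0 ≤ y) : x ≤ y ∨ y ≤ x := by
  obtain ⟨r, hr⟩ := hx
  obtain ⟨s, hs⟩ := hy
  rcases raw_R_total r s x y hr hs with h | h
  · exact Or.inr (sub_nonneg.1 ⟨r, h⟩)
  · exact Or.inl (sub_nonneg.1 ⟨s, h⟩)

/-- The only nontrivial case is two elements on the same side of `y`: their distances to `y` are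
nonnegative, and nonnegative elements are comparable. -/
lemma Near.trans {x y z : M} (h : Near x y) (h' : Near y z) : Near x z := by
  rcases h with h | h <;> rcases h' with h' | h'
  · exact Or.inl (h.trans h')
  · rcases nonneg_total (sub_nonneg.2 h) (sub_nonneg.2 h') with h1 | h1
    · exact Or.inr (sub_le_sub_iff_left _ |>.1 h1)
    · exact Or.inl (sub_le_sub_iff_left _ |>.1 h1)
  · rcases nonneg_total (sub_nonneg.2 h) (sub_nonneg.2 h') with h1 | h1
    · exact Or.inl (sub_le_sub_iff_right _ |>.1 h1)
    · exact Or.inr (sub_le_sub_iff_right _ |>.1 h1)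
  · exact Or.inr (h'.trans h)

lemma Near.add_right {x y : M} (h : Near x y) (z : M) : Near (x + z) (y + z) :=
  h.imp (fun h => add_le_add_left h z) (fun h => add_le_add_left h z)

lemma near_iff_sub {x y : M} : Near x y ↔ Near (x - y) 0 := by
  constructor
  · intro h; simpa [sub_eq_add_neg] using h.add_right (-y)
  · intro h; simpa using h.add_right y

variable (M) in
/-- The convex subgroup of bounded elements. -/
def bdd : Submodule ℚ M where
  carrier := {x | Near x 0}
  zero_mem' := Near.refl 0
  add_mem' {x y} hx hy := (by simpa using hx.add_right y : Near (x + y) y).trans hy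
  smul_mem' q x hx := by
    rcases le_total 0 q with hq | hq <;> rcases hx with hx | hx
    · exact Or.inl (smul_nonpos_of_nonneg_of_nonpos hq hx)
    · exact Or.inr (smul_nonneg hq hx)
    · exact Or.inr (smul_nonneg_of_nonpos_of_nonpos hq hx)
    · exact Or.inl (smul_nonpos_of_nonpos_of_nonneg hq hx)

lemma near_iff {x y : M} : Near x y ↔ x - y ∈ bdd M := near_iff_sub

lemma one_mem_bdd : (one : M) ∈ bdd M := Or.inr one_nonneg

lemma Near.lt_or_le {x y : M} (h : Near x y) : x < y ∨ y ≤ x := by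
  rcases h with h | h
  · exact h.lt_or_eq.imp_right ge_of_eq
  · exact Or.inr h

lemma Near.of_le {x y : M} (h : x ≤ y) : Near x y := Or.inl h

lemma Near.of_ge {x y : M} (h : y ≤ x) : Near x y := Or.inr h

lemma S_iff {r : PosRat} {x y : M} : S r x y ↔ -(r.1 • one) ≤ x - y ∧ x - y ≤ r.1 • one := by
  have h0 : (0 : M) ≤ r.1 • one := smul_nonneg r.2.le one_nonneg
  rw [S, R_iff, R_iff]
  constructor
  · rintro (⟨h1, h2⟩ | ⟨h1, h2⟩)
    · rw [← sub_nonpos] at h1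
      refine ⟨?_, h1.trans h0⟩
      rw [neg_le_sub_iff_le_add]; exact h2
    · rw [← sub_nonneg] at h1
      refine ⟨(neg_nonpos.2 h0).trans h1, ?_⟩
      rw [sub_le_iff_le_add']; exact h2
  · rintro ⟨h1, h2⟩
    rw [neg_le_sub_iff_le_add] at h1
    rw [sub_le_iff_le_add'] at h2
    have : Near x y := by
      refine (Near.of_le h2).trans ?_
      rw [near_iff, add_sub_cancel_left]
      exact (bdd M).smul_mem _ one_mem_bdd
    rcases this with h | h
    · exact Or.inl ⟨h, h1⟩
    · exact Or.inr ⟨h, h2⟩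

end Near

/-! ### Consequences of saturation -/

section Saturation

variable {M : Type u} [lang.Structure M]

/-- The set `s` is definable by a formula with parameters from `A`. -/
def IsDef (A s : Set M) : Prop :=
  ∃ φ : lang[[A]].Formula (Fin 1), ∀ x, x ∈ s ↔ φ.Realize (fun _ => x)

lemma isDef_iff_sum {A s : Set M} :
    IsDef A s ↔ ∃ φ : lang.Formula (A ⊕ Fin 1), ∀ x : M, x ∈ s ↔
      φ.Realize (Sum.elim (fun a : A => (a : M)) fun _ => x) := by
  rw [IsDef, Equiv.exists_congr_left BoundedFormula.constantsVarsEquiv]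
  refine exists_congr fun φ => forall_congr' fun x => iff_congr Iff.rfl ?_
  rw [Formula.Realize, Formula.Realize, ← BoundedFormula.realize_constantsVarsEquiv,
    Equiv.apply_symm_apply]
  rfl

lemma IsDef.compl {A s : Set M} (h : IsDef A s) : IsDef A sᶜ := by
  obtain ⟨φ, hφ⟩ := h
  exact ⟨φ.not, fun x => by rw [Formula.realize_not, ← hφ]; rfl⟩

lemma IsDef.inter {A s t : Set M} (hs : IsDef A s) (ht : IsDef A t) : IsDef A (s ∩ t) := by
  obtain ⟨φ, hφ⟩ := hs
  obtain ⟨ψ, hψ⟩ := ht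
  exact ⟨φ ⊓ ψ, fun x => by rw [Formula.realize_inf, ← hφ, ← hψ]; rfl⟩

lemma isDef_R_left {A : Set M} {a : M} (ha : a ∈ A) (r : PosRat) : IsDef A {y | R r a y} :=
  isDef_iff_sum.2 ⟨(relSymb r).formula₂ (Term.var (Sum.inl ⟨a, ha⟩)) (Term.var (Sum.inr 0)),
    fun x => by rw [Formula.realize_rel₂]; rfl⟩

lemma isDef_R_right {A : Set M} {a : M} (ha : a ∈ A) (r : PosRat) : IsDef A {y | R r y a} :=
  isDef_iff_sum.2 ⟨(relSymb r).formula₂ (Term.var (Sum.inr 0)) (Term.var (Sum.inl ⟨a, ha⟩)),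
    fun x => by rw [Formula.realize_rel₂]; rfl⟩

lemma isDef_singleton {A : Set M} {a : M} (ha : a ∈ A) : IsDef A {a} :=
  isDef_iff_sum.2 ⟨Term.equal (Term.var (Sum.inr 0)) (Term.var (Sum.inl ⟨a, ha⟩)),
    fun x => by simp [Formula.realize_equal]⟩

lemma isDef_fiber {A B : Set M} (hBA : B ⊆ A) {a : M} (ha : a ∈ A)
    (φ : lang[[B]].Formula (Fin 2)) : IsDef A {y | φ.Realize ![a, y]} := by
  refine isDef_iff_sum.2 ⟨Formula.relabel (Sum.elim (fun b : B => Sum.inl ⟨b, hBA b.2⟩)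
    ![Sum.inl ⟨a, ha⟩, Sum.inr 0]) (BoundedFormula.constantsVarsEquiv φ : lang.Formula _),
    fun x => ?_⟩
  rw [Formula.realize_relabel, Set.mem_ofPred_eq, Formula.Realize, Formula.Realize,
    ← BoundedFormula.realize_constantsVarsEquiv]
  refine iff_of_eq (congrArg (fun v => BoundedFormula.Realize _ v _) ?_)
  funext i
  rcases i with i | i
  · rfl
  · fin_cases i <;> rfl

/-- Saturation in terms of filters: finitely many of the conditions hold simultaneously at some `y
j`, because each holds eventually along a nontrivial filter. -/
lemma IsSaturated.exists_of_eventually {κ : Cardinal.{u}} (hM : IsSaturated lang M κ)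
    {A : Set M} (hA : #A < κ) {ι J : Type*} {s : ι → Set M} (hs : ∀ i, IsDef A (s i))
    (l : Filter J) [l.NeBot] (y : J → M) (h : ∀ i, ∀ᶠ j in l, y j ∈ s i) :
    ∃ x, ∀ i, x ∈ s i := by
  classical
  choose φ hφ using hs
  obtain ⟨x, hx⟩ := hM A hA (Set.range φ) (fun t ht => by
    have : ∀ᶠ j in l, ∀ ψ ∈ t, ψ.Realize (fun _ => y j) := by
      rw [eventually_all_finset]
      intro ψ hψ
      obtain ⟨i, rfl⟩ := ht ψ hψ
      exact (h i).mono fun j hj => (hφ i _).1 hj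
    obtain ⟨j, hj⟩ := this.exists
    exact ⟨y j, hj⟩)
  exact ⟨x, fun i => (hφ i x).2 (hx _ ⟨i, rfl⟩)⟩

variable [hM : M ⊨ theory]

/-- Midpoints of `x` and `y`, with `x` increasing in `X` and `y` decreasing in `Y`, eventually
satisfy each condition. -/
lemma IsSaturated.exists_between {κ : Cardinal.{u}} (hs : IsSaturated lang M κ) (hκ : ℵ₀ ≤ κ)
    {X Y : Set M} (hX : #X < κ) (hY : #Y < κ) (hX0 : X.Nonempty) (hY0 : Y.Nonempty)
    (h : ∀ x ∈ X, ∀ y ∈ Y, x < y) : ∃ z, (∀ x ∈ X, x < z) ∧ ∀ y ∈ Y, z < y := by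
  obtain ⟨x0, hx0⟩ := hX0
  obtain ⟨y0, hy0⟩ := hY0
  -- The order is an infinite disjunction of the `R_r`, so a radius is fixed for each element to
  -- make every condition a single formula.
  have h1 : ∀ x : X, ∃ r, R r (x : M) y0 := fun x => (h x x.2 y0 hy0).le
  have h2 : ∀ y : Y, ∃ r, R r x0 (y : M) := fun y => (h x0 hx0 y y.2).le
  choose r hr using h1
  choose r' hr' using h2
  have : Nonempty X := ⟨⟨x0, hx0⟩⟩
  have : Nonempty Y := ⟨⟨y0, hy0⟩⟩
  have : IsDirectedOrder X := ⟨fun a b => by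
    rcases (Near.of_le (h a a.2 y0 hy0).le).trans (Near.of_ge (h b b.2 y0 hy0).le) with h | h
    · exact ⟨b, h, le_rfl⟩
    · exact ⟨a, le_rfl, h⟩⟩
  have : IsCodirectedOrder Y := ⟨fun a b => by
    rcases (Near.of_ge (h x0 hx0 a a.2).le).trans (Near.of_le (h x0 hx0 b b.2).le) with h | h
    · exact ⟨a, le_rfl, h⟩
    · exact ⟨b, h, le_rfl⟩⟩
  obtain ⟨z, hz⟩ := hs.exists_of_eventually (A := X ∪ Y)
    ((mk_union_le _ _).trans_lt (add_lt_of_lt hκ hX hY)) (ι := X ⊕ Y)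
    (s := Sum.elim (fun x => {z | R (r x) (x : M) z} ∩ {(x : M)}ᶜ)
      (fun y => {z | R (r' y) z (y : M)} ∩ {(y : M)}ᶜ))
    (by
      rintro (x | y)
      · have hx := Set.mem_union_left Y x.2
        exact (isDef_R_left hx (r x)).inter (isDef_singleton hx).compl
      · have hy := Set.mem_union_right X y.2
        exact (isDef_R_right hy (r' y)).inter (isDef_singleton hy).compl)
    ((atTop : Filter X) ×ˢ (atBot : Filter Y))
    (fun p => (1 / 2 : ℚ) • ((p.1 : M) + p.2)) (by
      have e1 : ∀ p : X × Y, (p.1 : M) < (1 / 2 : ℚ) • ((p.1 : M) + p.2) := fun p => by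
        have := h p.1 p.1.2 p.2 p.2.2
        linear_combination (norm := exact le_of_eq (by module)) (1 / 2 : ℚ) • this
      have e2 : ∀ p : X × Y, (1 / 2 : ℚ) • ((p.1 : M) + p.2) < p.2 := fun p => by
        have := h p.1 p.1.2 p.2 p.2.2
        linear_combination (norm := exact le_of_eq (by module)) (1 / 2 : ℚ) • this
      rintro (x | y)
      · refine ((eventually_ge_atTop x).prod_mk (eventually_le_atBot ⟨y0, hy0⟩)).mono ?_
        rintro p ⟨h1, h2⟩
        have h3 : (x : M) < _ := lt_of_le_of_lt h1 (e1 p)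
        exact ⟨(R_iff _ _ _).2 ⟨h3.le, (e2 p).le.trans (le_trans h2 ((R_iff _ _ _).1 (hr x)).2)⟩,
          h3.ne'⟩
      · refine ((eventually_ge_atTop ⟨x0, hx0⟩).prod_mk (eventually_le_atBot y)).mono ?_
        rintro p ⟨h1, h2⟩
        have h3 : _ < (y : M) := lt_of_lt_of_le (e2 p) h2
        refine ⟨(R_iff _ _ _).2 ⟨h3.le, ((R_iff _ _ _).1 (hr' y)).2.trans ?_⟩, h3.ne⟩
        exact add_le_add_left (le_trans (show x0 ≤ (p.1 : M) from h1) (e1 p).le) _)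
  refine ⟨z, fun x hx => ?_, fun y hy => ?_⟩
  · have := hz (Sum.inl ⟨x, hx⟩)
    exact lt_of_le_of_ne ⟨_, this.1⟩ (Ne.symm this.2)
  · have := hz (Sum.inr ⟨y, hy⟩)
    exact lt_of_le_of_ne ⟨_, this.1⟩ this.2

/-- Were the multiples to return infinitely often to one ball of radius `r`, two indices `n < m` far
apart would give `|(m - n) d| ≤ 2 r`, hence `|d| ≤ s` for the given `s`. -/
lemma eventually_not_S {d : M} (hd : ¬ relE d 0) (x e : M) (r : PosRat) :
    ∀ᶠ n : ℕ in atTop, ¬ S r x (n • d + e) := by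
  simp only [relE, not_forall] at hd
  obtain ⟨s, hs⟩ := hd
  by_contra hcon
  simp only [not_eventually, not_not] at hcon
  obtain ⟨n, hn⟩ := hcon.exists
  obtain ⟨k, hk⟩ := exists_nat_gt (2 * r.1 / s.1)
  obtain ⟨m, hm, hmS⟩ := (frequently_atTop.1 hcon) (n + k)
  rw [S_iff] at *
  apply hs
  have hs0 := s.2
  have hr0 := r.2
  have hk0 : (0 : ℚ) < k := lt_trans (by positivity) hk
  have h0 : (0 : ℚ) < m - n := by
    have : ((n + k : ℕ) : ℚ) ≤ m := by exact_mod_cast hm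
    push_cast at this; linarith
  have h1 : 2 * r.1 ≤ (m - n : ℚ) * s.1 := by
    have : ((n + k : ℕ) : ℚ) ≤ m := by exact_mod_cast hm
    push_cast at this
    rw [div_lt_iff₀ hs0] at hk
    nlinarith
  have h2 : (2 * r.1) • (one : M) ≤ ((m - n : ℚ) * s.1) • one :=
    smul_le_smul_of_nonneg_right h1 one_nonneg
  rw [← Nat.cast_smul_eq_nsmul ℚ] at hn hmS
  have h3 : (m - n : ℚ) • -(s.1 • one) ≤ (m - n : ℚ) • (d - 0) := by
    linear_combination (norm := exact le_of_eq (by module)) h2 + hn.1 + hmS.2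
  have h4 : (m - n : ℚ) • (d - 0) ≤ (m - n : ℚ) • (s.1 • one) := by
    linear_combination (norm := exact le_of_eq (by module)) h2 + hn.2 + hmS.1
  exact ⟨le_of_smul_le_smul_left h3 h0, le_of_smul_le_smul_left h4 h0⟩

lemma IsSaturated.exists_not_near {κ : Cardinal.{u}} (hs : IsSaturated lang M κ) {A : Set M}
    (hA : #A < κ) : ∃ y, ∀ a ∈ A, ¬ Near a y := by
  have h1 : ¬ relE (one : M) 0 := fun h => by
    have := S_iff.1 (h ⟨1 / 2, by norm_num⟩)
    have h2 : (0 : M) < one := one_elt_pos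
    have h3 := this.2
    have : (one : M) ≤ 0 := by
      linear_combination (norm := exact le_of_eq (by module)) (2 : ℚ) • h3
    exact absurd this h2.not_ge
  obtain ⟨y, hy⟩ := hs.exists_of_eventually hA (ι := A × PosRat)
    (s := fun i => {y | R i.2 (i.1 : M) y}ᶜ ∩ {y | R i.2 y (i.1 : M)}ᶜ)
    (fun i => (isDef_R_left i.1.2 _).compl.inter (isDef_R_right i.1.2 _).compl)
    atTop (fun n : ℕ => n • one + 0) (fun i =>
      (eventually_not_S h1 i.1 0 i.2).mono fun n hn => not_or.1 hn)
  refine ⟨y, fun a ha h => ?_⟩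
  obtain ⟨r, hr⟩ := near_iff_exists_S.1 h
  exact not_or.2 (hy (⟨a, ha⟩, r)) hr

end Saturation

/-! ### Cardinalities of rational spans -/

section Card

variable {V : Type u} [AddCommGroup V] [Module ℚ V]

lemma mk_sup_span_singleton_lt {κ : Cardinal.{u}} (hκ : ℵ₀ < κ) {G : Submodule ℚ V}
    (hG : #G < κ) (p : V) : #(G ⊔ Submodule.span ℚ {p} : Submodule ℚ V) < κ := by
  have h : #(G ⊔ Submodule.span ℚ {p} : Submodule ℚ V) ≤ #(G × ULift.{u} ℚ) := by
    refine mk_le_of_surjective (f := fun x => ⟨x.1 + x.2.down • p, Submodule.add_mem_sup x.1.2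
      (Submodule.smul_mem _ _ (Submodule.mem_span_singleton_self p))⟩) ?_
    rintro ⟨x, hx⟩
    obtain ⟨g, hg, z, hz, rfl⟩ := Submodule.mem_sup.1 hx
    obtain ⟨q, rfl⟩ := Submodule.mem_span_singleton.1 hz
    exact ⟨(⟨g, hg⟩, ⟨q⟩), rfl⟩
  refine h.trans_lt ?_
  rw [mk_prod, lift_id, lift_id]
  exact mul_lt_of_lt hκ.le hG ((mk_le_aleph0).trans_lt hκ)

lemma mk_span_lt {κ : Cardinal.{u}} (hκ : ℵ₀ < κ) {s : Set V} (hs : #s < κ) :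
    #(Submodule.span ℚ s) < κ := by
  have h : #(Submodule.span ℚ s) ≤ #(s →₀ ℚ) := by
    rw [← Subtype.range_coe (s := s), ← Finsupp.range_linearCombination, Subtype.range_coe]
    exact mk_range_le (f := Finsupp.linearCombination ℚ ((↑) : s → V))
  refine h.trans_lt ?_
  rcases isEmpty_or_nonempty s with hs' | hs'
  · exact (mk_le_aleph0 (α := s →₀ ℚ)).trans_lt hκ
  · rw [mk_finsupp_lift_of_infinite']
    simpa using ⟨hs, hκ⟩

lemma mem_sup_span_singleton {G : Submodule ℚ V} {p x : V} :
    x ∈ G ⊔ Submodule.span ℚ {p} ↔ ∃ g ∈ G, ∃ q : ℚ, g + q • p = x := by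
  simp only [Submodule.mem_sup, Submodule.mem_span_singleton]
  constructor
  · rintro ⟨g, hg, _, ⟨q, rfl⟩, h⟩
    exact ⟨g, hg, q, h⟩
  · rintro ⟨g, hg, q, h⟩
    exact ⟨g, hg, _, ⟨q, rfl⟩, h⟩

end Card

/-! ### Back and forth between rational subspaces -/

section PartialIso

variable {M : Type u} [lang.Structure M] [hM : M ⊨ theory]

/-- The graph of a partial isomorphism between subspaces of `M`. -/
structure PartialIso (G : Submodule ℚ (M × M)) : Prop where
  one_mem : (one, one) ∈ G
  nonneg_iff : ∀ p ∈ G, 0 ≤ p.1 ↔ 0 ≤ p.2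

namespace PartialIso

variable {G : Submodule ℚ (M × M)} (hG : PartialIso G) {a b a' b' : M}
include hG

lemma le_iff (h : (a, b) ∈ G) (h' : (a', b') ∈ G) : a ≤ a' ↔ b ≤ b' := by
  have := hG.nonneg_iff _ (G.sub_mem h' h)
  simpa using this

lemma eq_iff (h : (a, b) ∈ G) (h' : (a', b') ∈ G) : a = a' ↔ b = b' := by
  rw [le_antisymm_iff, le_antisymm_iff, hG.le_iff h h', hG.le_iff h' h]

lemma lt_iff (h : (a, b) ∈ G) (h' : (a', b') ∈ G) : a < a' ↔ b < b' := by
  rw [lt_iff_le_not_ge, lt_iff_le_not_ge, hG.le_iff h h', hG.le_iff h' h]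

lemma near_iff (h : (a, b) ∈ G) (h' : (a', b') ∈ G) : Near a a' ↔ Near b b' := by
  rw [Near, Near, hG.le_iff h h', hG.le_iff h' h]

lemma add_smul_one_mem (h : (a, b) ∈ G) (q : ℚ) : (a + q • one, b + q • one) ∈ G :=
  G.add_mem h (G.smul_mem q hG.one_mem)

lemma R_iff (h : (a, b) ∈ G) (h' : (a', b') ∈ G) (r : PosRat) : R r a a' ↔ R r b b' := by
  rw [LocalOrder.R_iff, LocalOrder.R_iff, hG.le_iff h h',
    hG.le_iff h' (hG.add_smul_one_mem h r.1)]

lemma symm : PartialIso (G.map (LinearEquiv.prodComm ℚ M M).toLinearMap) where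
  one_mem := ⟨_, hG.one_mem, rfl⟩
  nonneg_iff := by
    rintro _ ⟨p, hp, rfl⟩
    exact (hG.nonneg_iff p hp).symm

/-- The sign of `a + q x` with `q ≠ 0` is decided by comparing `x` with `-q⁻¹ a`, which is again in
the domain. So it suffices that `x` and `y` compare in the same way with corresponding elements. -/
lemma sup_span {x y : M} (h : ∀ a b, (a, b) ∈ G → ((a ≤ x ↔ b ≤ y) ∧ (x ≤ a ↔ y ≤ b))) :
    PartialIso (G ⊔ Submodule.span ℚ {(x, y)}) where
  one_mem := le_sup_left (α := Submodule ℚ (M × M)) hG.one_mem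
  nonneg_iff := by
    intro p hp
    obtain ⟨⟨a, b⟩, hg, q, rfl⟩ := mem_sup_span_singleton.1 hp
    simp only [Prod.fst_add, Prod.smul_fst, Prod.snd_add, Prod.smul_snd]
    rcases lt_trichotomy q 0 with hq | rfl | hq
    · have e : ∀ c z : M, 0 ≤ c + q • z ↔ z ≤ (-q⁻¹) • c := fun c z => by
        have e1 : (-q⁻¹) • c - z = (-q⁻¹) • (c + q • z) := by
          rw [smul_add, smul_smul, neg_mul, inv_mul_cancel₀ hq.ne, neg_one_smul, sub_eq_add_neg]
        rw [← sub_nonneg (b := z), e1,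
          smul_nonneg_iff (neg_pos.2 (inv_lt_zero.2 hq))]
      rw [e, e]
      exact (h _ _ (G.smul_mem (-q⁻¹) hg)).2
    · simpa using hG.nonneg_iff _ hg
    · have e : ∀ c z : M, 0 ≤ c + q • z ↔ (-q⁻¹) • c ≤ z := fun c z => by
        have e1 : z - (-q⁻¹) • c = q⁻¹ • (c + q • z) := by
          rw [smul_add, smul_smul, inv_mul_cancel₀ hq.ne', one_smul, neg_smul, sub_neg_eq_add,
            add_comm]
        rw [← sub_nonneg (a := z), e1, smul_nonneg_iff (inv_pos.2 hq)]
      rw [e, e]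
      exact (h _ _ (G.smul_mem (-q⁻¹) hg)).1

lemma sup_span_of_not_near {x y : M} (hx : ∀ p ∈ G, ¬ Near p.1 x) (hy : ∀ p ∈ G, ¬ Near p.2 y) :
    PartialIso (G ⊔ Submodule.span ℚ {(x, y)}) :=
  hG.sup_span fun _ _ h => ⟨iff_of_false (fun h' => hx _ h (Or.inl h'))
    (fun h' => hy _ h (Or.inl h')), iff_of_false (fun h' => hx _ h (Or.inr h'))
    (fun h' => hy _ h (Or.inr h'))⟩

lemma exists_sup_span {κ : Cardinal.{u}} (hκ : ℵ₀ < κ) (hGκ : #G < κ) {x y : M}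
    (h : ∀ a b, (a, b) ∈ G → ((a ≤ x ↔ b ≤ y) ∧ (x ≤ a ↔ y ≤ b))) :
    ∃ G' : Submodule ℚ (M × M), PartialIso G' ∧ #G' < κ ∧ G ≤ G' ∧ (x, y) ∈ G' ∧
      ∀ p ∈ G', ∃ g ∈ G, ∃ q : ℚ, g + q • (x, y) = p :=
  ⟨_, hG.sup_span h, mk_sup_span_singleton_lt hκ hGκ _, le_sup_left,
    Submodule.mem_sup_right (Submodule.mem_span_singleton_self _),
    fun _ hp => mem_sup_span_singleton.1 hp⟩

lemma exists_sup_span_of_not_near {κ : Cardinal.{u}} (hκ : ℵ₀ < κ) (hGκ : #G < κ) {x y : M}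
    (hx : ∀ p ∈ G, ¬ Near p.1 x) (hy : ∀ p ∈ G, ¬ Near p.2 y) :
    ∃ G' : Submodule ℚ (M × M), PartialIso G' ∧ #G' < κ ∧ G ≤ G' ∧ (x, y) ∈ G' ∧
      ∀ p ∈ G', ∃ g ∈ G, ∃ q : ℚ, g + q • (x, y) = p :=
  ⟨_, hG.sup_span_of_not_near hx hy, mk_sup_span_singleton_lt hκ hGκ _, le_sup_left,
    Submodule.mem_sup_right (Submodule.mem_span_singleton_self _),
    fun _ hp => mem_sup_span_singleton.1 hp⟩

/-- If `x` is near the domain, its cut is transported to the range and filled by `exists_between`;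
if it is far from the domain, any element far from the range serves. -/
lemma exists_extension {κ : Cardinal.{u}} (hs : IsSaturated lang M κ) (hκ : ℵ₀ ≤ κ)
    (hGκ : #G < κ) (x : M) : ∃ y, PartialIso (G ⊔ Submodule.span ℚ {(x, y)}) := by
  by_cases h1 : ∃ b, (x, b) ∈ G
  · obtain ⟨b, hb⟩ := h1
    exact ⟨b, hG.sup_span fun _ _ h => ⟨hG.le_iff h hb, hG.le_iff hb h⟩⟩
  by_cases h2 : ∃ p ∈ G, Near p.1 x
  · obtain ⟨⟨a0, b0⟩, h0, hn⟩ := h2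
    simp only at hn
    have hne : ∀ p ∈ G, p.1 ≠ x := fun p hp h => h1 ⟨p.2, by rw [← h]; exact hp⟩
    obtain ⟨y, hy1, hy2⟩ := hs.exists_between hκ
      (X := (fun p : G => p.1.2) '' {p | p.1.1 ≤ x}) (Y := (fun p : G => p.1.2) '' {p | x ≤ p.1.1})
      (mk_image_le.trans_lt ((mk_set_le _).trans_lt hGκ))
      (mk_image_le.trans_lt ((mk_set_le _).trans_lt hGκ))
      (by
        -- Both sides of the cut are nonempty: `a0` lies on one side, and shifting it by a multiple
        -- of `1` reaches the other.
        rcases hn with h | h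
        · exact ⟨_, ⟨(a0, b0), h0⟩, h, rfl⟩
        · obtain ⟨n, -, hn⟩ := exists_nat_bound h
          refine ⟨_, ⟨_, hG.add_smul_one_mem h0 (-n)⟩, ?_, rfl⟩
          rw [← Nat.cast_smul_eq_nsmul ℚ] at hn
          change a0 + (-n : ℚ) • one ≤ x
          linear_combination (norm := exact le_of_eq (by module)) hn)
      (by
        rcases hn with h | h
        · obtain ⟨n, -, hn⟩ := exists_nat_bound h
          refine ⟨_, ⟨_, hG.add_smul_one_mem h0 n⟩, ?_, rfl⟩
          rw [← Nat.cast_smul_eq_nsmul ℚ] at hn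
          exact hn
        · exact ⟨_, ⟨(a0, b0), h0⟩, h, rfl⟩)
      (by
        rintro _ ⟨⟨⟨a, b⟩, hp⟩, hax, rfl⟩ _ ⟨⟨⟨a', b'⟩, hp'⟩, hax', rfl⟩
        exact (hG.lt_iff hp hp').1 (lt_of_lt_of_le (lt_of_le_of_ne hax (hne _ hp)) hax'))
    have hy1' : ∀ a b, (a, b) ∈ G → a ≤ x → b < y := fun a b h h' => hy1 _ ⟨⟨_, h⟩, h', rfl⟩
    have hy2' : ∀ a b, (a, b) ∈ G → x ≤ a → y < b := fun a b h h' => hy2 _ ⟨⟨_, h⟩, h', rfl⟩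
    have hyb : Near b0 y := hn.imp (fun h => (hy1' _ _ h0 h).le) (fun h => (hy2' _ _ h0 h).le)
    have hnear : ∀ a b, (a, b) ∈ G → Near b y → Near a x := fun a b h h' =>
      ((hG.near_iff h h0).2 (h'.trans hyb.symm)).trans hn
    refine ⟨y, hG.sup_span fun a b h => ⟨⟨fun h' => (hy1' a b h h').le, fun h' => ?_⟩,
      ⟨fun h' => (hy2' a b h h').le, fun h' => ?_⟩⟩⟩
    · exact (hnear a b h (Or.inl h')).resolve_right fun h'' => (hy2' a b h h'').not_ge h'
    · exact (hnear a b h (Or.inr h')).resolve_left fun h'' => (hy1' a b h h'').not_ge h'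
  · push Not at h2
    obtain ⟨y, hy⟩ := hs.exists_not_near (A := (fun p : G => p.1.2) '' Set.univ)
      (mk_image_le.trans_lt ((mk_set_le _).trans_lt hGκ))
    exact ⟨y, hG.sup_span_of_not_near h2 fun p hp => hy _ ⟨⟨p, hp⟩, trivial, rfl⟩⟩

lemma realize_mem {α : Type*} (v w : α → M) (hv : ∀ i, (v i, w i) ∈ G) (t : lang.Term α) :
    (t.realize v, t.realize w) ∈ G := by
  induction t with
  | var i => exact hv i
  | func f ts ih =>
    cases f with
    | one =>
      have e : ∀ v : α → M, (Term.func Func.one ts : lang.Term α).realize v = one := fun v => by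
        simp only [Term.realize, one]
        exact congrArg _ (Subsingleton.elim _ _)
      rw [e, e]
      exact hG.one_mem
    | neg =>
      have e : ∀ v : α → M, (Term.func Func.neg ts : lang.Term α).realize v =
          -(ts 0).realize v := fun v => by
        simp only [Term.realize, ← neg_eq, neg]
        exact congrArg _ (funext fun i => by rw [Subsingleton.elim i 0]; rfl)
      rw [e, e]
      exact G.neg_mem (ih 0)
    | add =>
      have e : ∀ v : α → M, (Term.func Func.add ts : lang.Term α).realize v =
          (ts 0).realize v + (ts 1).realize v := fun v => by
        simp only [Term.realize, ← add_eq, add]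
        exact congrArg _ (funext fun i => by fin_cases i <;> rfl)
      rw [e, e]
      exact G.add_mem (ih 0) (ih 1)

end PartialIso

/-- Induction on the formula; a quantifier is handled by adjoining one point to the graph, and the
reverse implication by applying the same argument to the inverse graph. -/
lemma IsSaturated.realize_iff {κ : Cardinal.{u}} (hs : IsSaturated lang M κ) (hκ : ℵ₀ < κ)
    {α : Type*} {n : ℕ} (φ : lang.BoundedFormula α n) :
    ∀ (G : Submodule ℚ (M × M)), PartialIso G → #G < κ → ∀ (v w : α → M) (xs ys : Fin n → M),
      (∀ i, (v i, w i) ∈ G) → (∀ i, (xs i, ys i) ∈ G) → (φ.Realize v xs ↔ φ.Realize w ys) := by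
  have mem : ∀ {n} (G : Submodule ℚ (M × M)) (v w : α → M) (xs ys : Fin n → M),
      (∀ i, (v i, w i) ∈ G) → (∀ i, (xs i, ys i) ∈ G) →
      ∀ i, (Sum.elim v xs i, Sum.elim w ys i) ∈ G := by
    rintro n G v w xs ys h h' (i | i)
    · exact h i
    · exact h' i
  induction φ with
  | falsum => intros; rfl
  | equal t₁ t₂ =>
    intro G hG _ v w xs ys h h'
    exact hG.eq_iff (hG.realize_mem _ _ (mem G v w xs ys h h') t₁)
      (hG.realize_mem _ _ (mem G v w xs ys h h') t₂)
  | rel S ts =>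
    intro G hG _ v w xs ys h h'
    cases S with
    | R r =>
      have e : ∀ (v : α → M) (xs : Fin _ → M),
          (BoundedFormula.rel (L := lang) (Rel.R r) ts).Realize v xs ↔
          R r ((ts 0).realize (Sum.elim v xs)) ((ts 1).realize (Sum.elim v xs)) := fun v xs => by
        refine iff_of_eq (congrArg (Structure.RelMap (relSymb r)) ?_)
        funext i
        fin_cases i <;> rfl
      rw [e, e]
      exact hG.R_iff (hG.realize_mem _ _ (mem G v w xs ys h h') _)
        (hG.realize_mem _ _ (mem G v w xs ys h h') _) r
  | imp φ ψ ih₁ ih₂ =>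
    intro G hG hGκ v w xs ys h h'
    rw [BoundedFormula.realize_imp, BoundedFormula.realize_imp, ih₁ G hG hGκ v w xs ys h h',
      ih₂ G hG hGκ v w xs ys h h']
  | all φ ih =>
    have key : ∀ (G : Submodule ℚ (M × M)), PartialIso G → #G < κ →
        ∀ (v w : α → M) (xs ys : Fin _ → M), (∀ i, (v i, w i) ∈ G) → (∀ i, (xs i, ys i) ∈ G) →
        φ.all.Realize w ys → φ.all.Realize v xs := by
      intro G hG hGκ v w xs ys h h' H x
      obtain ⟨y, hy⟩ := hG.exists_extension hs hκ.le hGκ x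
      have hle : G ≤ G ⊔ Submodule.span ℚ {(x, y)} := le_sup_left
      refine (ih _ hy (mk_sup_span_singleton_lt hκ hGκ _) v w (Fin.snoc xs x) (Fin.snoc ys y)
        (fun i => hle (h i)) (fun i => ?_)).2 (H y)
      refine Fin.lastCases ?_ (fun i => ?_) i
      · rw [Fin.snoc_last, Fin.snoc_last]
        exact le_sup_right (α := Submodule ℚ (M × M)) (Submodule.mem_span_singleton_self _)
      · rw [Fin.snoc_castSucc, Fin.snoc_castSucc]
        exact hle (h' i)
    intro G hG hGκ v w xs ys h h'
    refine ⟨key _ hG.symm ?_ w v ys xs (fun i => ⟨_, h i, rfl⟩) (fun i => ⟨_, h' i, rfl⟩),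
      key G hG hGκ v w xs ys h h'⟩
    refine lt_of_le_of_lt ?_ hGκ
    exact mk_le_of_surjective (f := fun p : G => ⟨_, Submodule.mem_map_of_mem p.2⟩) (by
      rintro ⟨_, p, hp, rfl⟩
      exact ⟨⟨p, hp⟩, rfl⟩)

lemma IsSaturated.realize_iff_of_partialIso {κ : Cardinal.{u}} (hs : IsSaturated lang M κ)
    (hκ : ℵ₀ < κ) {A : Set M} {α : Type*} (φ : lang[[A]].Formula α) {G : Submodule ℚ (M × M)}
    (hG : PartialIso G) (hGκ : #G < κ) (hA : ∀ a ∈ A, (a, a) ∈ G) (v w : α → M)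
    (h : ∀ i, (v i, w i) ∈ G) : φ.Realize v ↔ φ.Realize w := by
  rw [Formula.Realize, Formula.Realize, ← BoundedFormula.realize_constantsVarsEquiv,
    ← BoundedFormula.realize_constantsVarsEquiv (v := w)]
  refine hs.realize_iff hκ _ G hG hGκ _ _ _ _ ?_ (fun i => i.elim0)
  rintro (a | i)
  · exact hA a a.2
  · exact h i

variable (U : Submodule ℚ M)

/-- The graph of the identity of a subspace. -/
noncomputable def idGraph : Submodule ℚ (M × M) := U.map (LinearMap.id.prod LinearMap.id)

variable {U}

lemma mem_idGraph {p : M × M} : p ∈ idGraph U ↔ p.1 ∈ U ∧ p.1 = p.2 := by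
  constructor
  · rintro ⟨x, hx, rfl⟩
    exact ⟨hx, rfl⟩
  · rintro ⟨h1, h2⟩
    exact ⟨p.1, h1, Prod.ext rfl h2⟩

lemma partialIso_idGraph (h : one ∈ U) : PartialIso (idGraph U) where
  one_mem := mem_idGraph.2 ⟨h, rfl⟩
  nonneg_iff p hp := by rw [(mem_idGraph.1 hp).2]

lemma mk_idGraph_lt {κ : Cardinal.{u}} (hU : #U < κ) : #(idGraph U) < κ :=
  lt_of_le_of_lt (mk_le_of_surjective (f := fun p : U => ⟨_, Submodule.mem_map_of_mem p.2⟩) (by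
      rintro ⟨_, p, hp, rfl⟩
      exact ⟨⟨p, hp⟩, rfl⟩)) hU

lemma exists_idGraph {κ : Cardinal.{u}} (h : one ∈ U) (hU : #U < κ) :
    ∃ G : Submodule ℚ (M × M), PartialIso G ∧ #G < κ ∧ (∀ u ∈ U, (u, u) ∈ G) ∧
      ∀ p ∈ G, p.1 ∈ U ∧ p.1 = p.2 :=
  ⟨_, partialIso_idGraph h, mk_idGraph_lt hU, fun _ hu => mem_idGraph.2 ⟨hu, rfl⟩,
    fun _ hp => mem_idGraph.1 hp⟩

end PartialIso

/-! ### Realizing types, and uniqueness of the type at infinity -/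

section Types

variable {N : Type u} [lang.Structure N]

/-- The existential closure of a finite part of the type holds in some model of the complete theory
of `N`, hence in `N`; saturation realizes the whole type. -/
lemma IsSaturated.exists_typeOf_eq [Nonempty N] {κ : Cardinal.{u}} (hs : IsSaturated lang N κ)
    {A : Set N} (hA : #A < κ) (q : TypeOver lang A) :
    ∃ x : N, q = (lang[[A]].completeTheory N).typeOf fun _ => x := by
  obtain ⟨M', v, hv⟩ := Theory.exists_modelType_is_realized_in _ q
  obtain ⟨x, hx⟩ := hs A hA {φ | q.Contains φ} (fun s hsq => by
    let χ : lang[[A]].Formula (Fin 1) := s.toList.foldr (· ⊓ ·) ⊤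
    have h1 : M' ⊨ (Formula.iExs (Fin 1) (χ.relabel Sum.inr : lang[[A]].Formula (Empty ⊕ Fin 1)) :
        lang[[A]].Sentence) := by
      refine Formula.realize_iExs.2 ⟨v, ?_⟩
      rw [Formula.realize_relabel]
      refine (BoundedFormula.realize_foldr_inf _ _ _).2 fun φ hφ => ?_
      have := hsq φ (Finset.mem_toList.1 hφ)
      rw [Set.mem_ofPred_eq, TypeOver.Contains, ← hv] at this
      exact Theory.CompleteType.formula_mem_typeOf.1 this
    replace h1 := (realize_iff_of_model_completeTheory N M' _).1 h1
    obtain ⟨w, hw⟩ := Formula.realize_iExs.1 h1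
    rw [Formula.realize_relabel] at hw
    refine ⟨w 0, fun φ hφ => ?_⟩
    have := (BoundedFormula.realize_foldr_inf _ _ _).1 hw φ (Finset.mem_toList.2 hφ)
    have e : (fun _ => w 0) = Sum.elim (default : Empty → N) w ∘ Sum.inr := by
      funext i; rw [Subsingleton.elim i 0]; rfl
    rw [e]
    exact this)
  refine ⟨x, SetLike.ext fun φ => ?_⟩
  obtain ⟨ψ, rfl⟩ := Formula.equivSentence.surjective φ
  rw [Theory.CompleteType.formula_mem_typeOf]
  refine ⟨fun h => hx ψ h, fun h => ?_⟩
  by_contra hn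
  rw [← Theory.CompleteType.not_mem_iff] at hn
  exact hx ψ.not hn h

lemma mem_realizations_typeOf [Nonempty N] {A : Set N} {x y : N} :
    y ∈ TypeOver.realizations (L := lang) ((lang[[A]].completeTheory N).typeOf (fun _ => x)) ↔
      ∀ φ : lang[[A]].Formula (Fin 1), φ.Realize (fun _ => x) → φ.Realize (fun _ => y) :=
  forall_congr' fun _ => imp_congr_left Theory.CompleteType.formula_mem_typeOf

lemma realize_unrelatedFormula {A : Set N} {r : PosRat} {c : A} {x : N} :
    (unrelatedFormula r c).Realize (fun _ => x) ↔ ¬ S r (c : N) x := by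
  simp only [unrelatedFormula, Formula.realize_inf, Formula.realize_not, Formula.realize_rel₂,
    LHom.map_onRelation, S, not_or]
  rw [and_comm]
  rfl

lemma R_coe {C : lang.ElementarySubstructure N} (r : PosRat) (x y : C) :
    R r (x : N) y ↔ R r x y := by
  simp only [R]
  rw [← C.subtype.map_rel]
  exact iff_of_eq (congrArg _ (funext fun i => by fin_cases i <;> rfl))

variable [hN : N ⊨ theory]

lemma forall_realize_unrelatedFormula {A : Set N} {x : N} :
    (∀ (r : PosRat) (c : A), (unrelatedFormula r c).Realize (fun _ => x)) ↔
      ∀ c ∈ A, ¬ Near c x := by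
  simp only [realize_unrelatedFormula, near_iff_exists_S, not_exists]
  exact ⟨fun h c hc r => h r ⟨c, hc⟩, fun h r c => h c c.2 r⟩

variable (C : lang.ElementarySubstructure N)

/-- The inclusion of an elementary substructure, as a linear map. -/
noncomputable def inclusion : C →ₗ[ℚ] N :=
  AddMonoidHom.toRatLinearMap (AddMonoidHom.mk' (fun x : C => (x : N)) fun a b => by
    have : ((add a b : C) : N) = add (a : N) b := by
      simp only [add]
      rw [← C.coe_subtype, C.subtype.map_fun]
      exact congrArg _ (funext fun i => by fin_cases i <;> rfl)
    exact this)

lemma inclusion_apply (x : C) : inclusion C x = x := rfl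

/-- An elementary substructure, as a linear subspace. -/
noncomputable def subspace : Submodule ℚ N := LinearMap.range (inclusion C)

variable {C}

lemma mem_subspace {x : N} : x ∈ subspace C ↔ x ∈ C :=
  ⟨fun ⟨y, hy⟩ => hy ▸ y.2, fun h => ⟨⟨x, h⟩, rfl⟩⟩

/-- The order that `C` has as a model must be distinguished from the one it inherits as a subset of
`N`; they agree because `C` is a substructure. -/
lemma coe_lt_coe_iff {x y : C} : (x : N) < y ↔ modelPartialOrder.lt x y := by
  have h : ∀ x y : C, (x : N) ≤ y ↔ modelPartialOrder.le x y := fun x y =>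
    exists_congr fun r => R_coe r x y
  rw [lt_iff_le_not_ge, h, h]
  exact (@lt_iff_le_not_ge C modelPartialOrder.toPreorder x y).symm

lemma near_coe {x y : C} : Near (x : N) y ↔ Near x y := by
  rw [near_iff_exists_S, near_iff_exists_S]
  exact exists_congr fun r => or_congr (R_coe r x y) (R_coe r y x)

lemma one_mem_subspace : (one : N) ∈ subspace C := by
  refine ⟨one, ?_⟩
  rw [inclusion_apply]
  simp only [one]
  rw [← C.coe_subtype, C.subtype.map_fun]
  exact congrArg _ (Subsingleton.elim _ _)

lemma mk_subspace : #(subspace C) = #C :=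
  mk_congr (Equiv.subtypeEquivRight fun _ => mem_subspace)

/-- `x` and `y` are not near any element of `A`, so they have the same type over `A`. -/
lemma IsSaturated.realize_iff_of_not_near {κ : Cardinal.{u}} (hs : IsSaturated lang N κ)
    (hκ : ℵ₀ < κ) {U : Submodule ℚ N} (hU : #U < κ) (h1 : one ∈ U) {x y : N}
    (hx : ∀ c ∈ U, ¬ Near c x) (hy : ∀ c ∈ U, ¬ Near c y) {A : Set N} (hA : A ⊆ U)
    (φ : lang[[A]].Formula (Fin 1)) : φ.Realize (fun _ => x) ↔ φ.Realize (fun _ => y) := by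
  refine hs.realize_iff_of_partialIso hκ φ ((partialIso_idGraph h1).sup_span_of_not_near
    (x := x) (y := y) (fun p hp => ?_) (fun p hp => ?_))
    (mk_sup_span_singleton_lt hκ (mk_idGraph_lt hU) _)
    (fun a ha => le_sup_left (α := Submodule ℚ (N × N)) (mem_idGraph.2 ⟨hA ha, rfl⟩)) _ _
    (fun _ => le_sup_right (α := Submodule ℚ (N × N)) (Submodule.mem_span_singleton_self _))
  · exact hx _ (mem_idGraph.1 hp).1
  · rw [← (mem_idGraph.1 hp).2]
    exact hy _ (mem_idGraph.1 hp).1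

theorem exists_unique_type {κ' : Cardinal.{u}} (hκ' : ℵ₀ < κ') (hCκ' : #C < κ')
    (hs : IsSaturated lang N κ') :
    ∃ p : TypeOver lang (C : Set N), (∀ q : TypeOver lang (C : Set N), SaysUnrelated q ↔ q = p) ∧
      ∀ x, x ∈ p.realizations ↔ ∀ c ∈ C, ¬ Near c x := by
  have : Nonempty N := ⟨zero⟩
  obtain ⟨x, hx⟩ := hs.exists_not_near (A := (C : Set N)) hCκ'
  have key : ∀ y, (∀ c ∈ C, ¬ Near c y) → ∀ φ : lang[[(C : Set N)]].Formula (Fin 1),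
      φ.Realize (fun _ => x) ↔ φ.Realize (fun _ => y) := fun y hy φ =>
    hs.realize_iff_of_not_near hκ' (U := subspace C) (by rwa [mk_subspace]) one_mem_subspace
      (fun c hc => hx c (mem_subspace.1 hc)) (fun c hc => hy c (mem_subspace.1 hc))
      (fun c hc => mem_subspace.2 hc) φ
  have h_says : ∀ y : N, SaysUnrelated
      ((lang[[(C : Set N)]].completeTheory N).typeOf (fun _ => y) : TypeOver lang (C : Set N)) ↔
      ∀ c ∈ C, ¬ Near c y := fun y => by
    refine Iff.trans ?_ forall_realize_unrelatedFormula
    exact forall₂_congr fun r c => Theory.CompleteType.formula_mem_typeOf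
  refine ⟨(lang[[(C : Set N)]].completeTheory N).typeOf fun _ => x, fun q => ⟨fun hq => ?_, ?_⟩,
    fun y => ?_⟩
  · obtain ⟨y, rfl⟩ := hs.exists_typeOf_eq (A := (C : Set N)) hCκ' q
    refine SetLike.ext fun φ => ?_
    obtain ⟨ψ, rfl⟩ := Formula.equivSentence.surjective φ
    rw [Theory.CompleteType.formula_mem_typeOf, Theory.CompleteType.formula_mem_typeOf]
    exact (key y ((h_says y).1 hq) ψ).symm
  · rintro rfl
    exact (h_says x).2 hx
  · rw [mem_realizations_typeOf]
    refine ⟨fun h => ?_, fun h φ => (key y h φ).1⟩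
    exact forall_realize_unrelatedFormula.1 fun r c =>
      h _ (forall_realize_unrelatedFormula.2 hx r c)

end Types

/-! ### Infinitesimals -/

section Infinitesimal

variable {M : Type u} [lang.Structure M]

variable [hM : M ⊨ theory]

lemma mem_sup_bdd {V : Submodule ℚ M} {x : M} : x ∈ V ⊔ bdd M ↔ ∃ c ∈ V, Near c x := by
  rw [Submodule.mem_sup]
  constructor
  · rintro ⟨c, hc, b, hb, rfl⟩
    refine ⟨c, hc, near_iff.2 ?_⟩
    rw [sub_add_cancel_left]
    exact (bdd M).neg_mem hb
  · rintro ⟨c, hc, h⟩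
    exact ⟨c, hc, x - c, near_iff.1 h.symm, by abel⟩

lemma relE_iff_sub {x y : M} : relE x y ↔ relE (x - y) 0 := by
  simp only [relE, S_iff, sub_zero]

lemma relE_zero_neg {x : M} (h : relE x 0) : relE (-x) 0 := fun r => by
  have := S_iff.1 (h r)
  rw [sub_zero] at this
  rw [S_iff, sub_zero]
  exact ⟨neg_le_neg this.2, neg_le.1 this.1⟩

lemma relE_zero_add {x y : M} (hx : relE x 0) (hy : relE y 0) : relE (x + y) 0 := fun r => by
  have h1 := S_iff.1 (hx ⟨r.1 / 2, half_pos r.2⟩)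
  have h2 := S_iff.1 (hy ⟨r.1 / 2, half_pos r.2⟩)
  rw [S_iff]
  constructor
  · linear_combination (norm := exact le_of_eq (by module)) h1.1 + h2.1
  · linear_combination (norm := exact le_of_eq (by module)) h1.2 + h2.2

lemma relE.near {x y : M} (h : relE x y) : Near x y := near_iff_exists_S.2 ⟨1, h 1⟩

lemma relE.nsmul_le_one {h : M} (hh : relE h 0) (n : ℕ) : n • h ≤ one := by
  have h1 : (0 : ℚ) < n + 1 := by positivity
  have h2 := (S_iff.1 (hh ⟨1 / (n + 1), by positivity⟩)).2
  rw [sub_zero] at h2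
  have h3 := smul_le_smul_of_nonneg_left h2 n.cast_nonneg (α := ℚ)
  rw [Nat.cast_smul_eq_nsmul, smul_smul] at h3
  refine h3.trans ?_
  nth_rewrite 2 [← one_smul ℚ one]
  refine smul_le_smul_of_nonneg_right ?_ one_nonneg
  simp only
  rw [mul_one_div, div_le_one h1]
  linarith

lemma relE_zero_of_le {x y : M} (hy : relE y 0) (h1 : -y ≤ x) (h2 : x ≤ y) : relE x 0 := fun r => by
  have := S_iff.1 (hy r)
  rw [sub_zero] at this
  rw [S_iff, sub_zero]
  exact ⟨(neg_le_neg this.2).trans h1, h2.trans this.2⟩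

lemma isPosInfinitesimal_iff {a : M} : IsPosInfinitesimal a ↔ 0 < a ∧ relE a 0 := by
  constructor
  · rintro ⟨h1, h2⟩
    exact ⟨lt_of_le_of_ne ⟨1, h2 1⟩ (Ne.symm h1), fun r => Or.inr (h2 r)⟩
  · rintro ⟨h1, h2⟩
    refine ⟨h1.ne', fun r => (R_iff _ _ _).2 ⟨h1.le, ?_⟩⟩
    have := (S_iff.1 (h2 r)).2
    rw [sub_zero] at this
    rw [zero_eq, zero_add]
    exact this

/-- The upper bound hidden in `R_1` is automatic: if `-z ≤ a` then `a - z ≤ 2 a ≤ 1`, since `a` is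
infinitesimal. -/
lemma relEA_iff {A : Set M} (hA : ∀ a ∈ A, IsPosInfinitesimal a) {x y : M} :
    relEA A x y ↔ ∀ a ∈ A, ∀ n : ℕ, 0 < n → n • (x - y) ≤ a ∧ n • (y - x) ≤ a := by
  refine forall₄_congr fun a ha n hn => ?_
  have h := (isPosInfinitesimal_iff.1 (hA a ha)).2
  have h1 : a ≤ one := by simpa using h.nsmul_le_one 1
  rw [R_iff, R_iff, nmul_eq, nmul_eq, sub_eq, sub_eq]
  constructor
  · rintro ⟨⟨h2, -⟩, h3, -⟩
    exact ⟨h2, h3⟩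
  · have e : n • (y - x) = -(n • (x - y)) := by rw [← smul_neg, neg_sub]
    have e1 : ((1 : PosRat) : ℚ) • (one : M) = one := one_smul ℚ one
    rintro ⟨h2, h3⟩
    rw [e1]
    have hn1 : ∀ z : M, z ≤ a → -z ≤ a → a ≤ z + one := fun z hz1 hz2 => by
      have h4 : (2 : ℕ) • a ≤ one := h.nsmul_le_one 2
      linear_combination (norm := exact le_of_eq (by module)) h4 + hz2
    exact ⟨⟨h2, hn1 _ h2 (e ▸ h3)⟩, h3, hn1 _ h3 (by rw [e, neg_neg]; exact h2)⟩

lemma relEA_iff_sub {A : Set M} {x y : M} : relEA A x y ↔ relEA A (x - y) 0 := by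
  simp only [relEA, sub_eq, sub_zero, zero_sub, neg_sub]

end Infinitesimal

/-! ### Type-definable equivalence relations: invariance and limits -/

section RelData

variable {N : Type u} [lang.Structure N] [hN : N ⊨ theory]

/-- A partial type `π(x, y)` over a subspace `U` of a subspace `V`, which defines an equivalence
relation on the set of elements not near any element of `V`. -/
structure RelData (N : Type u) [lang.Structure N] [hN : N ⊨ theory] (κ' : Cardinal.{u}) where
  sat : IsSaturated lang N κ'
  aleph0_lt : ℵ₀ < κ'
  V : Submodule ℚ N
  U : Submodule ℚ N
  one_mem : one ∈ U
  U_le : U ≤ V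
  mk_V : #V < κ'
  B : Set N
  B_sub : B ⊆ U
  π : Set (lang[[B]].Formula (Fin 2))
  refl : ∀ x ∉ V ⊔ bdd N, ∀ φ ∈ π, φ.Realize ![x, x]
  symm : ∀ x ∉ V ⊔ bdd N, ∀ y ∉ V ⊔ bdd N, (∀ φ ∈ π, φ.Realize ![x, y]) →
    ∀ φ ∈ π, φ.Realize ![y, x]
  trans : ∀ x ∉ V ⊔ bdd N, ∀ y ∉ V ⊔ bdd N, ∀ z ∉ V ⊔ bdd N, (∀ φ ∈ π, φ.Realize ![x, y]) →
    (∀ φ ∈ π, φ.Realize ![y, z]) → ∀ φ ∈ π, φ.Realize ![x, z]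

namespace RelData

variable {κ' : Cardinal.{u}} (D : RelData N κ')

/-- The relation defined by the partial type. -/
def Holds (x y : N) : Prop := ∀ φ ∈ D.π, φ.Realize ![x, y]

/-- The subspace of the elements near some element of `V`. -/
noncomputable def W : Submodule ℚ N := D.V ⊔ bdd N

variable {D}

lemma V_le_W : D.V ≤ D.W := le_sup_left

lemma bdd_le_W : bdd N ≤ D.W := le_sup_right

lemma Near.mem_W {x y : N} (h : Near x y) (hx : x ∈ D.W) : y ∈ D.W := by
  have := D.W.sub_mem hx (bdd_le_W (near_iff.1 h))
  rwa [sub_sub_cancel] at this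

lemma mem_W_of_near_zero {x : N} (h : Near x 0) : x ∈ D.W := bdd_le_W h

lemma Holds.symm {x y : N} (hx : x ∉ D.W) (hy : y ∉ D.W) (h : D.Holds x y) : D.Holds y x :=
  D.symm x hx y hy h

lemma Holds.trans {x y z : N} (hx : x ∉ D.W) (hy : y ∉ D.W) (hz : z ∉ D.W) (h : D.Holds x y)
    (h' : D.Holds y z) : D.Holds x z :=
  D.trans x hx y hy z hz h h'

lemma holds_refl {x : N} (hx : x ∉ D.W) : D.Holds x x := D.refl x hx

lemma mk_U : #D.U < κ' := (mk_le_mk_of_subset D.U_le).trans_lt D.mk_V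

lemma holds_congr {G : Submodule ℚ (N × N)} (hG : PartialIso G) (hGκ : #G < κ')
    (hU : ∀ u ∈ D.U, (u, u) ∈ G) {x y x' y' : N} (hx : (x, x') ∈ G) (hy : (y, y') ∈ G) :
    D.Holds x y ↔ D.Holds x' y' := by
  refine forall₂_congr fun φ _ => D.sat.realize_iff_of_partialIso D.aleph0_lt φ hG hGκ
    (fun a ha => hU a (D.B_sub ha)) _ _ fun i => ?_
  fin_cases i
  · exact hx
  · exact hy

lemma exists_notMem_sup {V : Submodule ℚ N} (hV : #V < κ') (hs : IsSaturated lang N κ') :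
    ∃ x, x ∉ V ⊔ bdd N := by
  obtain ⟨x, hx⟩ := hs.exists_not_near (A := (V : Set N)) hV
  exact ⟨x, fun h => let ⟨c, hc, hcx⟩ := mem_sup_bdd.1 h; hx c hc hcx⟩

variable (D) in
lemma exists_notMem_W : ∃ x, x ∉ D.W := exists_notMem_sup D.mk_V D.sat

/-- Whether `q x + d` is related to `x` depends only on the cut of `d` in `U`. -/
lemma holds_iff_of_cut {x x' d d' : N} (hx : x ∉ D.W) (hx' : x' ∉ D.W) (hd : d ∈ D.W)
    (hd' : d' ∈ D.W) (h : ∀ u ∈ D.U, (u ≤ d ↔ u ≤ d') ∧ (d ≤ u ↔ d' ≤ u)) (q : ℚ) :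
    D.Holds x (q • x + d) ↔ D.Holds x' (q • x' + d') := by
  -- The identity of `U` is extended by `d ↦ d'`, which the equality of cuts permits, then by `x ↦
  -- x'`, which is unconstrained because `x` and `x'` are far from everything obtained so far.
  obtain ⟨G, hG, hGκ, hGU, hGmem⟩ := exists_idGraph D.one_mem D.mk_U
  obtain ⟨G₁, hG₁, hGκ₁, hle₁, hd₁, hGmem₁⟩ := hG.exists_sup_span D.aleph0_lt hGκ (x := d)
    (y := d') fun a b hab => by
      obtain ⟨ha, hb⟩ := hGmem _ hab
      simp only at ha hb
      rw [← hb]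
      exact h a ha
  have hW : ∀ p ∈ G₁, p.1 ∈ D.W ∧ p.2 ∈ D.W := by
    intro p hp
    obtain ⟨g, hg, s, rfl⟩ := hGmem₁ p hp
    obtain ⟨hg1, hg2⟩ := hGmem _ hg
    have hg3 := V_le_W (D.U_le hg1)
    exact ⟨D.W.add_mem hg3 (D.W.smul_mem s hd), D.W.add_mem (hg2 ▸ hg3) (D.W.smul_mem s hd')⟩
  obtain ⟨G₂, hG₂, hGκ₂, hle₂, hx₂, -⟩ := hG₁.exists_sup_span_of_not_near D.aleph0_lt hGκ₁
    (x := x) (y := x') (fun p hp h' => hx (Near.mem_W h' (hW p hp).1))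
    (fun p hp h' => hx' (Near.mem_W h' (hW p hp).2))
  exact holds_congr hG₂ hGκ₂ (fun u hu => hle₂ (hle₁ (hGU u hu))) hx₂
    (G₂.add_mem (G₂.smul_mem q hx₂) (hle₂ hd₁))

lemma holds_iff {x x' d : N} (hx : x ∉ D.W) (hx' : x' ∉ D.W) (hd : d ∈ D.W) (q : ℚ) :
    D.Holds x (q • x + d) ↔ D.Holds x' (q • x' + d) :=
  holds_iff_of_cut hx hx' hd hd (fun _ _ => ⟨Iff.rfl, Iff.rfl⟩) q

lemma holds_iff_of_independent {x x' y y' : N} (hx : x ∉ D.W) (hx' : x' ∉ D.W)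
    (hy : y ∉ D.W ⊔ Submodule.span ℚ {x}) (hy' : y' ∉ D.W ⊔ Submodule.span ℚ {x'}) :
    D.Holds x y ↔ D.Holds x' y' := by
  obtain ⟨G, hG, hGκ, hGU, hGmem⟩ := exists_idGraph D.one_mem D.mk_U
  have hW : ∀ p ∈ G, p.1 ∈ D.W ∧ p.2 ∈ D.W := fun p hp => by
    obtain ⟨hp1, hp2⟩ := hGmem p hp
    have hp3 := V_le_W (D.U_le hp1)
    exact ⟨hp3, hp2 ▸ hp3⟩
  obtain ⟨G₁, hG₁, hGκ₁, hle₁, hx₁, hGmem₁⟩ := hG.exists_sup_span_of_not_near D.aleph0_lt hGκ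
    (x := x) (y := x') (fun p hp h' => hx (Near.mem_W h' (hW p hp).1))
    (fun p hp h' => hx' (Near.mem_W h' (hW p hp).2))
  have near_mem : ∀ {z w v : N}, Near z w → z ∈ D.W ⊔ Submodule.span ℚ {v} →
      w ∈ D.W ⊔ Submodule.span ℚ {v} := fun {z w v} hzw hz => by
    have := Submodule.sub_mem _ hz
      (Submodule.mem_sup_left (T := Submodule.span ℚ {v}) (bdd_le_W (D := D) (near_iff.1 hzw)))
    rwa [sub_sub_cancel] at this
  have hW₁ : ∀ p ∈ G₁,
      p.1 ∈ D.W ⊔ Submodule.span ℚ {x} ∧ p.2 ∈ D.W ⊔ Submodule.span ℚ {x'} := by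
    intro p hp
    obtain ⟨g, hg, s, rfl⟩ := hGmem₁ p hp
    exact ⟨mem_sup_span_singleton.2 ⟨g.1, (hW g hg).1, s, rfl⟩,
      mem_sup_span_singleton.2 ⟨g.2, (hW g hg).2, s, rfl⟩⟩
  obtain ⟨G₂, hG₂, hGκ₂, hle₂, hy₂, -⟩ := hG₁.exists_sup_span_of_not_near D.aleph0_lt hGκ₁
    (x := y) (y := y') (fun p hp h' => hy (near_mem h' (hW₁ p hp).1))
    (fun p hp h' => hy' (near_mem h' (hW₁ p hp).2))
  exact holds_congr hG₂ hGκ₂ (fun u hu => hle₂ (hle₁ (hGU u hu))) (hle₂ hx₁) hy₂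

variable (D) in
/-- The relation is total. -/
def IsTotal : Prop := ∀ x ∉ D.W, ∀ y ∉ D.W, D.Holds x y

/-- All independent pairs look alike over `U`, so all of them are related. Given `x'` and `y'`, an
element `z` independent of each of them links the two by transitivity. -/
lemma isTotal_of_independent {x y : N} (hx : x ∉ D.W) (hy : y ∉ D.W ⊔ Submodule.span ℚ {x})
    (h : D.Holds x y) : D.IsTotal := by
  intro x' hx' y' hy'
  obtain ⟨z, hz⟩ := exists_notMem_sup (V := D.V ⊔ Submodule.span ℚ {x'} ⊔ Submodule.span ℚ {y'})
    (mk_sup_span_singleton_lt D.aleph0_lt (mk_sup_span_singleton_lt D.aleph0_lt D.mk_V _) _) D.sat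
  have hz1 : z ∉ D.W ⊔ Submodule.span ℚ {x'} := fun h' => hz (by
    refine (?_ : D.W ⊔ Submodule.span ℚ {x'} ≤ _) h'
    exact sup_le (sup_le_sup_right (le_sup_left.trans le_sup_left) _)
      ((le_sup_right.trans le_sup_left).trans le_sup_left))
  have hz2 : z ∉ D.W ⊔ Submodule.span ℚ {y'} := fun h' => hz (by
    refine (?_ : D.W ⊔ Submodule.span ℚ {y'} ≤ _) h'
    exact sup_le (sup_le_sup_right (le_sup_left.trans le_sup_left) _)
      (le_sup_right.trans le_sup_left))
  have hzW : z ∉ D.W := fun h' => hz1 (Submodule.mem_sup_left h')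
  have h1 := (holds_iff_of_independent hx hx' hy hz1).1 h
  have h2 := (holds_iff_of_independent hx hy' hy hz2).1 h
  exact h1.trans hx' hzW hy' (h2.symm hy' hzW)

/-- Limits of elements related to `x`. -/
lemma Holds.exists_limit {x : N} {A : Set N} (hA : #A < κ') {J : Type*} (l : Filter J) [l.NeBot]
    (y : J → N) (hy : ∀ j, D.Holds x (y j)) :
    ∃ z, D.Holds x z ∧ ∀ a ∈ A, ∀ r : PosRat,
      ((∀ᶠ j in l, R r a (y j)) → R r a z) ∧ ((∀ᶠ j in l, R r (y j) a) → R r z a) ∧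
      ((∀ᶠ j in l, ¬ S r a (y j)) → ¬ S r a z) := by
  have hA' : #(A ∪ D.B ∪ {x} : Set N) < κ' := by
    refine (mk_union_le _ _).trans_lt (add_lt_of_lt D.aleph0_lt.le
      ((mk_union_le _ _).trans_lt (add_lt_of_lt D.aleph0_lt.le hA ?_)) ?_)
    · exact (mk_le_mk_of_subset D.B_sub).trans_lt mk_U
    · rw [mk_singleton]
      exact one_lt_aleph0.trans D.aleph0_lt
  -- The conditions on the limit are the formulas of `π(x, ·)` and all atomic conditions over `A`
  -- that hold eventually.
  let ι := D.π ⊕ ({p : A × PosRat // ∀ᶠ j in l, R p.2 (p.1 : N) (y j)} ⊕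
    ({p : A × PosRat // ∀ᶠ j in l, R p.2 (y j) (p.1 : N)} ⊕
      {p : A × PosRat // ∀ᶠ j in l, ¬ S p.2 (p.1 : N) (y j)}))
  let s : ι → Set N := Sum.elim (fun φ => {y | φ.1.Realize ![x, y]})
    (Sum.elim (fun p => {y | R p.1.2 (p.1.1 : N) y})
      (Sum.elim (fun p => {y | R p.1.2 y (p.1.1 : N)})
        (fun p => {y | R p.1.2 (p.1.1 : N) y}ᶜ ∩ {y | R p.1.2 y (p.1.1 : N)}ᶜ)))
  have mem : ∀ a : A, (a : N) ∈ (A ∪ D.B ∪ {x} : Set N) := fun a =>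
    Set.mem_union_left _ (Set.mem_union_left _ a.2)
  obtain ⟨z, hz⟩ := D.sat.exists_of_eventually hA' (ι := ι) (s := s) (by
      rintro (φ | p | p | p)
      · exact isDef_fiber (Set.subset_union_right.trans Set.subset_union_left)
          (Set.mem_union_right _ (Set.mem_singleton x)) φ.1
      · exact isDef_R_left (mem _) p.1.2
      · exact isDef_R_right (mem _) p.1.2
      · exact (isDef_R_left (mem _) p.1.2).compl.inter (isDef_R_right (mem _) p.1.2).compl) l y (by
      rintro (φ | p | p | p)
      · exact Eventually.of_forall fun j => hy j φ.1 φ.2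
      · exact p.2
      · exact p.2
      · exact p.2.mono fun j hj => not_or.1 hj)
  refine ⟨z, fun φ hφ => hz (Sum.inl ⟨φ, hφ⟩), fun a ha r =>
    ⟨fun h => ?_, fun h => ?_, fun h => ?_⟩⟩
  · exact hz (Sum.inr (Sum.inl ⟨(⟨a, ha⟩, r), h⟩))
  · exact hz (Sum.inr (Sum.inr (Sum.inl ⟨(⟨a, ha⟩, r), h⟩)))
  · exact not_or.2 (hz (Sum.inr (Sum.inr (Sum.inr ⟨(⟨a, ha⟩, r), h⟩))))

/-- A limit of the `y n` is still related to `x` and is far from `V + ℚx`, hence independent of `x`.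
-/
lemma isTotal_of_eventually {x : N} (hx : x ∉ D.W) (y : ℕ → N) (hy : ∀ n, D.Holds x (y n))
    (h : ∀ a ∈ D.V ⊔ Submodule.span ℚ {x}, ∀ r : PosRat, ∀ᶠ n in atTop, ¬ S r a (y n)) :
    D.IsTotal := by
  obtain ⟨z, hz, hz'⟩ := Holds.exists_limit
    (A := (D.V ⊔ Submodule.span ℚ {x} : Submodule ℚ N))
    (mk_sup_span_singleton_lt D.aleph0_lt D.mk_V x) atTop y hy
  refine isTotal_of_independent hx (fun hzx => ?_) hz
  rw [W, sup_right_comm] at hzx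
  obtain ⟨a, ha, hn⟩ := mem_sup_bdd.1 hzx
  obtain ⟨r, hr⟩ := near_iff_exists_S.1 hn
  exact (hz' a ha r).2.2 (h a ha r) hr

end RelData

end RelData

/-! ### Translations, reflections and the group `H` -/

section Classification

variable {N : Type u} [lang.Structure N] [hN : N ⊨ theory]

namespace RelData

variable {κ' : Cardinal.{u}} {D : RelData N κ'}

lemma add_notMem_W {x d : N} (hx : x ∉ D.W) (hd : d ∈ D.W) : x + d ∉ D.W := fun h =>
  hx ((D.W.add_mem_iff_left hd).1 h)

lemma smul_add_notMem_W {x d : N} (hx : x ∉ D.W) (hd : d ∈ D.W) {q : ℚ} (hq : q ≠ 0) :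
    q • x + d ∉ D.W := fun h =>
  hx ((D.W.smul_mem_iff hq).1 ((D.W.add_mem_iff_left hd).1 h))

lemma exists_smul_add (hT : ¬ D.IsTotal) {x y : N} (hx : x ∉ D.W) (hy : y ∉ D.W)
    (h : D.Holds x y) : ∃ q : ℚ, q ≠ 0 ∧ ∃ d ∈ D.W, y = q • x + d := by
  have hy' : y ∈ D.W ⊔ Submodule.span ℚ {x} := by
    by_contra hy'
    exact hT (isTotal_of_independent hx hy' h)
  obtain ⟨d, hd, q, rfl⟩ := mem_sup_span_singleton.1 hy'
  refine ⟨q, ?_, d, hd, add_comm _ _⟩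
  rintro rfl
  exact hy (by simpa using hd)

/-- Since translation by `d` preserves classes, `x` is related to every `x + n d`. If `d` is not
infinitesimal, these leave every ball. -/
lemma relE_of_holds_add (hT : ¬ D.IsTotal) {x d : N} (hx : x ∉ D.W) (hd : d ∈ D.W)
    (h : D.Holds x (x + d)) : relE d 0 := by
  by_contra hd0
  refine hT (isTotal_of_eventually hx (fun n => n • d + x) (fun n => ?_)
    fun a _ r => eventually_not_S hd0 a x r)
  have hn : ∀ n : ℕ, n • d + x ∉ D.W := fun n h' =>
    hx ((D.W.add_mem_iff_right (D.W.smul_of_tower_mem n hd)).1 h')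
  induction n with
  | zero => simpa using holds_refl hx
  | succ n ih =>
    refine Holds.trans hx (hn n) (hn _) ih ?_
    have := (holds_iff hx (hn n) hd 1).1 (by rwa [one_smul])
    rwa [one_smul, add_right_comm, ← succ_nsmul] at this

/-- The iterates of `z ↦ q z + d` at `x` are all related to `x` and are congruent to `q ^ n x`
modulo `W`. The powers `q ^ n` are distinct, so the iterates eventually avoid every ball around a
given element of `V + ℚx`. -/
lemma isTotal_of_holds_smul_add {x d : N} (hx : x ∉ D.W) (hd : d ∈ D.W) {q : ℚ} (hq0 : q ≠ 0)
    (hq : |q| ≠ 1) (h : D.Holds x (q • x + d)) : D.IsTotal := by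
  let Y : ℕ → N := fun n => (fun z => q • z + d)^[n] x
  have hY : ∀ n, Y (n + 1) = q • Y n + d := fun n => Function.iterate_succ_apply' _ _ _
  have hYW : ∀ n, Y n ∉ D.W := fun n => by
    induction n with
    | zero => exact hx
    | succ n ih => rw [hY]; exact smul_add_notMem_W ih hd hq0
  have hYq : ∀ n, Y n - q ^ n • x ∈ D.W := fun n => by
    induction n with
    | zero => simp [Y]
    | succ n ih =>
      have : Y (n + 1) - q ^ (n + 1) • x = q • (Y n - q ^ n • x) + d := by
        rw [hY]; module
      rw [this]
      exact D.W.add_mem (D.W.smul_mem q ih) hd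
  refine isTotal_of_eventually hx Y (fun n => ?_) fun a ha r => ?_
  · induction n with
    | zero => exact holds_refl hx
    | succ n ih =>
      refine Holds.trans hx (hYW n) (hYW _) ih ?_
      rw [hY]
      exact (holds_iff hx (hYW n) hd q).1 h
  · obtain ⟨c, hc, s, rfl⟩ := mem_sup_span_singleton.1 ha
    have hfin : {n : ℕ | q ^ n = s}.Finite := by
      refine Set.Subsingleton.finite fun m hm n hn => ?_
      refine pow_right_injective₀ (abs_pos.2 hq0) hq ?_
      simp only [← abs_pow]
      rw [show q ^ m = s from hm, show q ^ n = s from hn]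
    have := hfin.eventually_cofinite_notMem
    rw [Nat.cofinite_eq_atTop] at this
    refine this.mono fun n hn hS => hn ?_
    by_contra hne
    have h1 : c + s • x - Y n ∈ D.W := bdd_le_W (near_iff.1 (near_iff_exists_S.2 ⟨r, hS⟩))
    have h2 := D.W.sub_mem (D.W.add_mem h1 (hYq n)) (V_le_W hc)
    have h3 : c + s • x - Y n + (Y n - q ^ n • x) - c = (s - q ^ n) • x := by module
    rw [h3] at h2
    exact hx ((D.W.smul_mem_iff (sub_ne_zero.2 fun h => hne h.symm)).1 h2)

lemma eq_add_or_eq_neg_add (hT : ¬ D.IsTotal) {x y : N} (hx : x ∉ D.W) (hy : y ∉ D.W)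
    (h : D.Holds x y) : ∃ d ∈ D.W, y = x + d ∨ y = -x + d := by
  obtain ⟨q, hq, d, hd, rfl⟩ := exists_smul_add hT hx hy h
  by_cases hq1 : |q| = 1
  · refine ⟨d, hd, ?_⟩
    rcases (abs_eq zero_le_one).1 hq1 with rfl | rfl
    · exact Or.inl (by rw [one_smul])
    · exact Or.inr (by rw [neg_one_smul])
  · exact absurd (isTotal_of_holds_smul_add hx hd hq hq1 h) hT

variable (D) in
/-- The differences of related elements. -/
def H : Set N := {d | d ∈ D.W ∧ ∀ x ∉ D.W, D.Holds x (x + d)}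

lemma mem_H {x d : N} (hx : x ∉ D.W) (hd : d ∈ D.W) (h : D.Holds x (x + d)) : d ∈ D.H :=
  ⟨hd, fun x' hx' => by
    have := (holds_iff hx hx' hd 1).1 (by rwa [one_smul])
    rwa [one_smul] at this⟩

lemma zero_mem_H : (0 : N) ∈ D.H :=
  ⟨D.W.zero_mem, fun x hx => by rw [add_zero]; exact holds_refl hx⟩

lemma add_mem_H {a b : N} (ha : a ∈ D.H) (hb : b ∈ D.H) : a + b ∈ D.H := by
  refine ⟨D.W.add_mem ha.1 hb.1, fun x hx => ?_⟩
  have h1 := add_notMem_W hx ha.1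
  rw [← add_assoc]
  exact (ha.2 x hx).trans hx h1 (add_notMem_W h1 hb.1) (hb.2 _ h1)

lemma neg_mem_H {a : N} (ha : a ∈ D.H) : -a ∈ D.H := by
  refine ⟨D.W.neg_mem ha.1, fun x hx => ?_⟩
  have h1 := add_notMem_W hx (D.W.neg_mem ha.1)
  have := ha.2 _ h1
  rw [neg_add_cancel_right] at this
  exact this.symm h1 hx

lemma sub_mem_H {a b : N} (ha : a ∈ D.H) (hb : b ∈ D.H) : a - b ∈ D.H := by
  rw [sub_eq_add_neg]
  exact add_mem_H ha (neg_mem_H hb)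

lemma nsmul_mem_H {a : N} (ha : a ∈ D.H) (n : ℕ) : n • a ∈ D.H := by
  induction n with
  | zero => rw [zero_smul]; exact zero_mem_H
  | succ n ih => rw [succ_nsmul]; exact add_mem_H ih ha

lemma relE_of_mem_H (hT : ¬ D.IsTotal) {d : N} (hd : d ∈ D.H) : relE d 0 := by
  obtain ⟨x, hx⟩ := exists_notMem_W D
  exact relE_of_holds_add hT hx hd.1 (hd.2 x hx)

lemma near_zero_of_mem_H (hT : ¬ D.IsTotal) {d : N} (hd : d ∈ D.H) : Near d 0 :=
  (relE_of_mem_H hT hd).near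

lemma mem_H_of_cut {d d' : N} (hd : d ∈ D.H) (hd' : d' ∈ D.W)
    (h : ∀ u ∈ D.U, (u ≤ d ↔ u ≤ d') ∧ (d ≤ u ↔ d' ≤ u)) : d' ∈ D.H := by
  obtain ⟨x, hx⟩ := exists_notMem_W D
  have := (holds_iff_of_cut hx hx hd.1 hd' h 1).1 (by rw [one_smul]; exact hd.2 x hx)
  rw [one_smul] at this
  exact mem_H hx hd' this

/-- Limits of elements of `H`. -/
lemma exists_limit_H {s : N} {J : Type*} (l : Filter J) [l.NeBot] (h : J → N)
    (hh : ∀ j, h j ∈ D.H) (h0 : ∀ j, 0 ≤ h j) (h1 : ∀ j, h j ≤ one) :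
    ∃ g ∈ D.H, 0 ≤ g ∧ ∀ u ∈ D.U ⊔ Submodule.span ℚ {s},
      (0 ≤ u → (∀ᶠ j in l, u ≤ h j) → u ≤ g) ∧ ((∀ᶠ j in l, h j ≤ u) → g ≤ u) := by
  obtain ⟨x, hx⟩ := exists_notMem_W D
  obtain ⟨z, hz, hz'⟩ := Holds.exists_limit (x := x)
    (A := (D.U ⊔ Submodule.span ℚ {s} ⊔ Submodule.span ℚ {x} : Submodule ℚ N))
    (mk_sup_span_singleton_lt D.aleph0_lt (mk_sup_span_singleton_lt D.aleph0_lt D.mk_U _) _)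
    l (fun j => x + h j) (fun j => (hh j).2 x hx)
  have hA : ∀ u ∈ D.U ⊔ Submodule.span ℚ {s},
      x + u ∈ D.U ⊔ Submodule.span ℚ {s} ⊔ Submodule.span ℚ {x} := fun u hu =>
    Submodule.add_mem _ (Submodule.mem_sup_right (Submodule.mem_span_singleton_self _))
      (Submodule.mem_sup_left hu)
  have lower : ∀ u ∈ D.U ⊔ Submodule.span ℚ {s}, 0 ≤ u → (∀ᶠ j in l, u ≤ h j) → u ≤ z - x := by
    intro u hu hu0 hev
    have := (hz' _ (hA u hu) 1).1 (hev.mono fun j hj => (R_iff _ _ _).2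
      ⟨add_le_add_right hj x, by
        have e1 : ((1 : PosRat) : ℚ) • (one : N) = one := one_smul ℚ one
        rw [e1]
        linear_combination (norm := exact le_of_eq (by module)) h1 j + hu0⟩)
    exact le_sub_iff_add_le'.2 ((R_iff _ _ _).1 this).1
  have upper : ∀ u ∈ D.U ⊔ Submodule.span ℚ {s}, (∀ᶠ j in l, h j ≤ u) → z - x ≤ u := by
    intro u hu hev
    obtain ⟨j, hj⟩ := hev.exists
    obtain ⟨r, hr⟩ := (h0 j).trans hj
    have hr' := ((R_iff _ _ _).1 hr).2
    rw [zero_add] at hr'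
    have := (hz' _ (hA u hu) r).2.1 (hev.mono fun j hj => (R_iff _ _ _).2
      ⟨add_le_add_right hj x, by
        linear_combination (norm := exact le_of_eq (by module)) hr' + h0 j⟩)
    exact sub_le_iff_le_add'.2 ((R_iff _ _ _).1 this).1
  have hz0 : 0 ≤ z - x := lower 0 (Submodule.zero_mem _) le_rfl (Eventually.of_forall h0)
  refine ⟨z - x, mem_H hx (mem_W_of_near_zero (Or.inr hz0)) (by rwa [add_sub_cancel]), hz0,
    fun u hu => ⟨lower u hu, upper u hu⟩⟩

lemma not_le_of_not_near {u g : N} (hu : ¬ Near u 0) (hg : Near g 0) : ¬ u ≤ g ∧ ¬ g ≤ u :=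
  ⟨fun h => hu ((Near.of_le h).trans hg), fun h => hu ((Near.of_ge h).trans hg)⟩

/-- Convexity of `H`. A limit `g ∈ H` of the multiples `n h` lies above all of them, but below every
upper bound of them in `U + ℚh`. Adding `h' ≤ h` therefore does not change its cut over `U`, so `g +
h'` is in `H`, and so is the difference `h'`. -/
lemma mem_H_of_le (hT : ¬ D.IsTotal) {h h' : N} (hh : h ∈ D.H) (h0 : 0 ≤ h') (hle : h' ≤ h) :
    h' ∈ D.H := by
  rcases (h0.trans hle).eq_or_lt with rfl | hpos
  · rw [le_antisymm hle h0]; exact zero_mem_H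
  have hinf := relE_of_mem_H hT hh
  obtain ⟨g, hg, hg0, hgu⟩ := exists_limit_H (s := h) atTop (fun n : ℕ => n • h)
    (nsmul_mem_H hh) (fun n => nsmul_nonneg hpos.le n) (fun n => hinf.nsmul_le_one n)
  have hmem : ∀ n : ℕ, n • h ∈ D.U ⊔ Submodule.span ℚ {h} := fun n =>
    Submodule.smul_of_tower_mem _ n (Submodule.mem_sup_right (Submodule.mem_span_singleton_self _))
  have hng : ∀ n : ℕ, n • h ≤ g := fun n => (hgu _ (hmem n)).1 (nsmul_nonneg hpos.le n)
    ((eventually_ge_atTop n).mono fun m hm => nsmul_le_nsmul_left hpos.le hm)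
  have hgn : Near g 0 := Or.inr hg0
  have hgh0 : 0 ≤ g + h' := add_nonneg hg0 h0
  have hgh : Near (g + h') 0 := Or.inr hgh0
  have hgle : g ≤ g + h' := le_add_of_nonneg_right h0
  suffices hs : g + h' ∈ D.H by
    have := sub_mem_H hs hg
    rwa [add_sub_cancel_left] at this
  refine mem_H_of_cut hg (mem_W_of_near_zero hgh) fun u hu => ?_
  by_cases hu0 : Near u 0
  · by_cases hex : ∃ n : ℕ, u ≤ n • h
    · obtain ⟨n, hn⟩ := hex
      have h1 : u < g := by
        refine lt_of_lt_of_le (lt_of_le_of_lt hn ?_) (hng (n + 1))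
        rw [succ_nsmul]
        exact lt_add_of_pos_right _ hpos
      exact ⟨iff_of_true h1.le (h1.le.trans hgle),
        iff_of_false h1.not_ge (h1.trans_le hgle).not_ge⟩
    · have h2 : g ≤ u - 2 • h := by
        refine (hgu _ (Submodule.sub_mem _ (Submodule.mem_sup_left hu) (hmem 2))).2
          (Eventually.of_forall fun n => ?_)
        have hnear : Near u ((n + 2) • h) :=
          hu0.trans (Near.of_le (nsmul_nonneg hpos.le (n + 2)))
        have h3 := hnear.resolve_left fun h' => hex ⟨_, h'⟩
        rw [add_smul] at h3
        exact le_sub_iff_add_le.2 h3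
      have h3 : g + h' < u := by
        linear_combination (norm := exact le_of_eq (by module)) h2 + hle + hpos
      have h4 : g < u := hgle.trans_lt h3
      exact ⟨iff_of_false h4.not_ge h3.not_ge, iff_of_true h4.le h3.le⟩
  · have h1 := not_le_of_not_near hu0 hgn
    have h2 := not_le_of_not_near hu0 hgh
    exact ⟨iff_of_false h1.1 h2.1, iff_of_false h1.2 h2.2⟩

/-- If `g` exceeds all of `H`, it is compared with a limit `g'` of the positive elements of `H`:
both lie above `U ∩ H` and below the positive bounded elements of `U` outside `H`, so they have the
same cut over `U`. -/
lemma mem_H_of_forall_lt (hT : ¬ D.IsTotal) {h₀ g : N} (hh₀ : h₀ ∈ D.H) (h₀pos : 0 < h₀)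
    (hg0 : 0 < g) (hgu : ∀ u ∈ D.U, 0 < u → u ∉ D.H → Near u 0 → g < u) :
    g ∈ D.H := by
  by_cases hex : ∃ h ∈ D.H, g ≤ h
  · obtain ⟨h, hh, hgh⟩ := hex
    exact mem_H_of_le hT hh hg0.le hgh
  push Not at hex
  have hgn : Near g 0 := Or.inr hg0.le
  have hlt : ∀ h ∈ D.H, h < g := fun h hh => by
    have : Near h g := (near_zero_of_mem_H hT hh).trans hgn.symm
    exact this.lt_or_le.resolve_right (hex h hh)
  let J := {h : N // h ∈ D.H ∧ 0 < h}
  have : Nonempty J := ⟨⟨h₀, hh₀, h₀pos⟩⟩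
  have : IsDirectedOrder J := ⟨fun a b => by
    rcases nonneg_total a.2.2.le b.2.2.le with h | h
    · exact ⟨b, h, le_rfl⟩
    · exact ⟨a, le_rfl, h⟩⟩
  obtain ⟨g', hg', hg'0, hg'u⟩ := exists_limit_H (s := h₀) (atTop : Filter J) (fun j => (j : N))
    (fun j => j.2.1) (fun j => j.2.2.le)
    (fun j => by simpa using (relE_of_mem_H hT j.2.1).nsmul_le_one 1)
  have hh₀m : h₀ ∈ D.U ⊔ Submodule.span ℚ {h₀} :=
    Submodule.mem_sup_right (Submodule.mem_span_singleton_self _)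
  have low : ∀ u ∈ D.U ⊔ Submodule.span ℚ {h₀}, u ∈ D.H → u ≤ g' := fun u hu huH => by
    rcases (near_zero_of_mem_H hT huH).symm.lt_or_le with h | h
    · exact (hg'u u hu).1 h.le ((eventually_ge_atTop (⟨u, huH, h⟩ : J)).mono fun j hj => hj)
    · exact h.trans hg'0
  refine mem_H_of_cut hg' (mem_W_of_near_zero hgn) fun u hu => ?_
  have hu' := Submodule.mem_sup_left (T := Submodule.span ℚ {h₀}) hu
  by_cases hu0 : Near u 0
  · have below : u < g → u < g' → (u ≤ g' ↔ u ≤ g) ∧ (g' ≤ u ↔ g ≤ u) := fun h1 h2 =>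
      ⟨iff_of_true h2.le h1.le, iff_of_false h2.not_ge h1.not_ge⟩
    by_cases huH : u ∈ D.H
    · refine below (hlt u huH) (lt_of_lt_of_le (lt_add_of_pos_right u h₀pos) ?_)
      exact low _ (Submodule.add_mem _ hu' hh₀m) (add_mem_H huH hh₀)
    rcases hu0.symm.lt_or_le with h | h
    · have h1 := hgu u hu h huH hu0
      -- By convexity `u / 2` still bounds `H`, since an element of `H` above it would have its
      -- double above `u`.
      have h2 : g' ≤ (1 / 2 : ℚ) • u := by
        refine (hg'u _ (Submodule.smul_mem _ _ hu')).2 (Eventually.of_forall fun j => ?_)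
        have hnear : Near ((1 / 2 : ℚ) • u) j :=
          ((bdd N).smul_mem (1 / 2 : ℚ) hu0 : Near _ _).trans (Or.inl j.2.2.le)
        refine hnear.lt_or_le.resolve_left fun hlt' => huH ?_
        refine mem_H_of_le hT (add_mem_H j.2.1 j.2.1) h.le ?_
        linear_combination (norm := exact le_of_eq (by module)) (2 : ℚ) • hlt'.le
      have h3 : g' < u := by
        linear_combination (norm := exact le_of_eq (by module)) h2 + (1 / 2 : ℚ) • h
      exact ⟨iff_of_false h3.not_ge h1.not_ge, iff_of_true h3.le h1.le⟩
    · exact below (lt_of_le_of_lt h hg0) (lt_of_le_of_lt h (h₀pos.trans_le (low _ hh₀m hh₀)))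
  · have hg'n : Near g' 0 := Or.inr hg'0
    have h1 := not_le_of_not_near hu0 hg'n
    have h2 := not_le_of_not_near hu0 hgn
    exact ⟨iff_of_false h1.1 h2.1, iff_of_false h1.2 h2.2⟩

lemma lt_of_not_relE {g u : N} (hg : relE g 0) (hg0 : 0 ≤ g) (hu : 0 ≤ u) (hu' : ¬ relE u 0) :
    g < u := by
  have : Near g u := (Near.of_ge hg0).trans (Or.inl hu)
  refine this.lt_or_le.resolve_right fun h => hu' (relE_zero_of_le hg ?_ h)
  exact (neg_nonpos.2 hg0).trans hu

theorem H_classification (hT : ¬ D.IsTotal) :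
    (∀ d, d ∈ D.H ↔ d = 0) ∨ (∀ d, d ∈ D.H ↔ relE d 0) ∨
      ∃ A : Set N, A ⊆ D.U ∧ A.Nonempty ∧ (∀ a ∈ A, IsPosInfinitesimal a) ∧
        ∀ d, d ∈ D.H ↔ relEA A d 0 := by
  by_cases hz : ∀ d ∈ D.H, d = 0
  · exact Or.inl fun d => ⟨hz d, fun h => h ▸ zero_mem_H⟩
  right
  obtain ⟨h₀, hh₀, h₀pos⟩ : ∃ h₀ ∈ D.H, 0 < h₀ := by
    push Not at hz
    obtain ⟨d, hd, hd0⟩ := hz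
    rcases near_zero_of_mem_H hT hd with h | h
    · exact ⟨-d, neg_mem_H hd, neg_pos.2 (lt_of_le_of_ne h hd0)⟩
    · exact ⟨d, hd, lt_of_le_of_ne h hd0.symm⟩
  have of_pos : ∀ S : N → Prop, (∀ d, S d → relE d 0) → (∀ d, S d → S (-d)) →
      (∀ d, S d → 0 < d → d ∈ D.H) → ∀ d, S d → d ∈ D.H := by
    intro S hS hneg hpos d hd
    rcases (hS d hd).near with h | h
    · rcases h.lt_or_eq with h | rfl
      · simpa using neg_mem_H (hpos _ (hneg d hd) (neg_pos.2 h))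
      · exact zero_mem_H
    · rcases h.lt_or_eq with h | rfl
      · exact hpos d hd h
      · exact zero_mem_H
  by_cases hA : ∃ u ∈ D.U, 0 < u ∧ relE u 0 ∧ u ∉ D.H
  · right
    -- The set `A` consists of all positive infinitesimals of `U` that witness the failure of `H` to
    -- contain every infinitesimal.
    refine ⟨{u | u ∈ D.U ∧ 0 < u ∧ relE u 0 ∧ u ∉ D.H}, fun u hu => hu.1, hA,
      fun a ha => isPosInfinitesimal_iff.2 ⟨ha.2.1, ha.2.2.1⟩, fun d => ?_⟩
    rw [relEA_iff (fun a ha => isPosInfinitesimal_iff.2 ⟨ha.2.1, ha.2.2.1⟩)]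
    simp only [sub_zero, zero_sub]
    constructor
    · intro hd
      have key : ∀ a, 0 < a ∧ a ∉ D.H → ∀ e ∈ D.H, e ≤ a := fun a ha e he => by
        have : Near a e := (Near.of_ge ha.1.le).trans (near_zero_of_mem_H hT he).symm
        exact this.resolve_left fun hae => ha.2 (mem_H_of_le hT he ha.1.le hae)
      exact fun a ha n _ => ⟨key a ⟨ha.2.1, ha.2.2.2⟩ _ (nsmul_mem_H hd n),
        key a ⟨ha.2.1, ha.2.2.2⟩ _ (nsmul_mem_H (neg_mem_H hd) n)⟩
    · obtain ⟨a, haU, ha0, ha, haH⟩ := hA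
      have hrel : ∀ d : N, (∀ a ∈ {u | u ∈ D.U ∧ 0 < u ∧ relE u 0 ∧ u ∉ D.H}, ∀ n : ℕ, 0 < n →
          n • d ≤ a ∧ n • -d ≤ a) → relE d 0 := fun d hd => by
        have := hd a ⟨haU, ha0, ha, haH⟩ 1 one_pos
        rw [one_smul, one_smul] at this
        exact relE_zero_of_le ha (neg_le.1 this.2) this.1
      refine of_pos _ hrel (fun d hd a ha n hn => ?_) (fun d hd hd0 => ?_) d
      · rw [neg_neg]
        exact (hd a ha n hn).symm
      · refine mem_H_of_forall_lt hT hh₀ h₀pos hd0 fun u hu hu0 huH _ => ?_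
        by_cases hue : relE u 0
        -- The multiple `n = 2` turns the weak bound into the required strict one.
        · refine lt_of_lt_of_le ?_ (hd u ⟨hu, hu0, hue, huH⟩ 2 two_pos).1
          rw [two_nsmul]
          exact lt_add_of_pos_right d hd0
        · exact lt_of_not_relE (hrel d hd) hd0.le hu0.le hue
  · left
    push Not at hA
    refine fun d => ⟨relE_of_mem_H hT, of_pos _ (fun _ h => h) (fun _ => relE_zero_neg)
      (fun d hd hd0 => ?_) d⟩
    exact mem_H_of_forall_lt hT hh₀ h₀pos hd0 fun u hu hu0 huH _ =>
      lt_of_not_relE hd hd0.le hu0.le fun hue => huH (hA u hu hu0 hue)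

/-- If some `x` is related to `-x + d`, then `d` may be replaced by `c ∈ V` with the same cut over
`U`, and every `x` is related to `-x + c`. Comparing with this reflected point turns any other
related `-x + d` into a translation by `d - c ∈ H`. -/
theorem classification
    (hC : ∀ d ∈ D.W, ∃ c ∈ D.V, ∀ u ∈ D.U, (u ≤ d ↔ u ≤ c) ∧ (d ≤ u ↔ c ≤ u)) :
    D.IsTotal ∨ (∀ x ∉ D.W, ∀ y ∉ D.W, D.Holds x y ↔ x - y ∈ D.H) ∨
      ∃ c ∈ D.V, ∀ x ∉ D.W, ∀ y ∉ D.W, D.Holds x y ↔ x - y ∈ D.H ∨ x + y - c ∈ D.H := by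
  rw [or_iff_not_imp_left]
  intro hT
  have h_sub : ∀ x ∉ D.W, ∀ y ∉ D.W, x - y ∈ D.H → D.Holds x y := fun x hx y hy h => by
    have := (neg_mem_H h).2 x hx
    rwa [neg_sub, add_sub_cancel] at this
  by_cases hne : ∃ x ∉ D.W, ∃ d ∈ D.W, D.Holds x (-x + d)
  · right
    obtain ⟨x₀, hx₀, d₀, hd₀, h₀⟩ := hne
    obtain ⟨c, hc, hcut⟩ := hC d₀ hd₀
    have hcW := V_le_W hc
    have hneg : ∀ x ∉ D.W, -x + c ∉ D.W := fun x hx => by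
      rw [← neg_one_smul ℚ]
      exact smul_add_notMem_W hx hcW (by norm_num)
    have hxc : ∀ x ∉ D.W, D.Holds x (-x + c) := fun x hx => by
      rw [← neg_one_smul ℚ] at h₀ ⊢
      exact (holds_iff_of_cut hx₀ hx hd₀ hcW hcut (-1)).1 h₀
    refine ⟨c, hc, fun x hx y hy => ⟨fun h => ?_, ?_⟩⟩
    · obtain ⟨d, hd, rfl | rfl⟩ := eq_add_or_eq_neg_add hT hx hy h
      · left
        rw [sub_add_cancel_left]
        exact neg_mem_H (mem_H hx hd h)
      · right
        rw [add_neg_cancel_left]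
        refine mem_H (hneg x hx) (D.W.sub_mem hd hcW) ?_
        have := ((hxc x hx).symm hx (hneg x hx)).trans (hneg x hx) hx hy h
        rwa [add_assoc, add_sub_cancel]
    · rintro (h | h)
      · exact h_sub x hx y hy h
      · have := h.2 _ (hneg x hx)
        have e : -x + c + (x + y - c) = y := by abel
        rw [e] at this
        exact (hxc x hx).trans hx (hneg x hx) hy this
  · left
    refine fun x hx y hy => ⟨fun h => ?_, h_sub x hx y hy⟩
    obtain ⟨d, hd, rfl | rfl⟩ := eq_add_or_eq_neg_add hT hx hy h
    · rw [sub_add_cancel_left]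
      exact neg_mem_H (mem_H hx hd h)
    · exact absurd ⟨x, hx, d, hd, h⟩ hne

end RelData

end Classification

/-! ### Type-definability of the listed relations -/

section TypeDefinable

variable {N : Type u} [lang.Structure N]

/-- The relation `F` is type-definable over `B`. -/
def IsTypeDef (B : Set N) (F : N → N → Prop) : Prop :=
  ∃ Γ : Set (lang.Formula (B ⊕ Fin 2)), ∀ x y, F x y ↔
    ∀ ψ ∈ Γ, ψ.Realize (Sum.elim (fun b : B => (b : N)) ![x, y])

/-- The function `f` is given by a term with parameters from `B`. -/
def IsTermFun (B : Set N) (f : N → N → N) : Prop :=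
  ∃ t : lang.Term (B ⊕ Fin 2), ∀ x y, f x y = t.realize (Sum.elim (fun b : B => (b : N)) ![x, y])

variable {B : Set N}

lemma isTermFun_fst : IsTermFun B fun x _ => x := ⟨Term.var (Sum.inr 0), fun _ _ => rfl⟩

lemma isTermFun_snd : IsTermFun B fun _ y => y := ⟨Term.var (Sum.inr 1), fun _ _ => rfl⟩

lemma isTermFun_const {b : N} (hb : b ∈ B) : IsTermFun B fun _ _ => b :=
  ⟨Term.var (Sum.inl ⟨b, hb⟩), fun _ _ => rfl⟩

lemma IsTermFun.add {f g : N → N → N} (hf : IsTermFun B f) (hg : IsTermFun B g) :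
    IsTermFun B fun x y => add (f x y) (g x y) := by
  obtain ⟨s, hs⟩ := hf
  obtain ⟨t, ht⟩ := hg
  exact ⟨addTerm s t, fun x y => by
    dsimp only
    rw [realize_addTerm, hs, ht]⟩

lemma IsTermFun.sub {f g : N → N → N} (hf : IsTermFun B f) (hg : IsTermFun B g) :
    IsTermFun B fun x y => sub (f x y) (g x y) := by
  obtain ⟨s, hs⟩ := hf
  obtain ⟨t, ht⟩ := hg
  exact ⟨addTerm s (negTerm t), fun x y => by
    dsimp only
    rw [realize_addTerm, realize_negTerm, hs, ht]; rfl⟩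

lemma IsTermFun.nmul {f : N → N → N} (hf : IsTermFun B f) (n : ℕ) :
    IsTermFun B fun x y => nmul n (f x y) := by
  obtain ⟨s, hs⟩ := hf
  exact ⟨nmulTerm n s, fun x y => by
    dsimp only
    rw [realize_nmulTerm, hs]⟩

lemma isTypeDef_R {f g : N → N → N} (hf : IsTermFun B f) (hg : IsTermFun B g) (r : PosRat) :
    IsTypeDef B fun x y => R r (f x y) (g x y) := by
  obtain ⟨s, hs⟩ := hf
  obtain ⟨t, ht⟩ := hg
  refine ⟨{(relSymb r).formula₂ s t}, fun x y => ?_⟩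
  simp only [Set.mem_singleton_iff, forall_eq]
  rw [Formula.realize_rel₂, hs, ht]
  rfl

lemma isTypeDef_eq {f g : N → N → N} (hf : IsTermFun B f) (hg : IsTermFun B g) :
    IsTypeDef B fun x y => f x y = g x y := by
  obtain ⟨s, hs⟩ := hf
  obtain ⟨t, ht⟩ := hg
  refine ⟨{s.equal t}, fun x y => ?_⟩
  simp only [Set.mem_singleton_iff, forall_eq]
  rw [Formula.realize_equal, hs, ht]

lemma IsTypeDef.all {ι : Sort*} {F : ι → N → N → Prop} (h : ∀ i, IsTypeDef B (F i)) :
    IsTypeDef B fun x y => ∀ i, F i x y := by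
  choose Γ hΓ using h
  refine ⟨⋃ i, Γ i, fun x y => ?_⟩
  simp only [hΓ, Set.mem_iUnion]
  exact ⟨fun h ψ ⟨i, hi⟩ => h i ψ hi, fun h i ψ hi => h ψ ⟨i, hi⟩⟩

lemma IsTypeDef.and {F G : N → N → Prop} (hF : IsTypeDef B F) (hG : IsTypeDef B G) :
    IsTypeDef B fun x y => F x y ∧ G x y := by
  obtain ⟨Γ, hΓ⟩ := hF
  obtain ⟨Δ, hΔ⟩ := hG
  refine ⟨Γ ∪ Δ, fun x y => ?_⟩
  dsimp only
  rw [hΓ, hΔ]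
  exact ⟨fun h ψ hψ => hψ.elim (h.1 ψ) (h.2 ψ),
    fun h => ⟨fun ψ hψ => h ψ (Or.inl hψ), fun ψ hψ => h ψ (Or.inr hψ)⟩⟩

/-- A disjunction of two partial types is axiomatized by the pairwise disjunctions of their
formulas. -/
lemma IsTypeDef.or {F G : N → N → Prop} (hF : IsTypeDef B F) (hG : IsTypeDef B G) :
    IsTypeDef B fun x y => F x y ∨ G x y := by
  obtain ⟨Γ, hΓ⟩ := hF
  obtain ⟨Δ, hΔ⟩ := hG
  refine ⟨Set.image2 (· ⊔ ·) Γ Δ, fun x y => ?_⟩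
  dsimp only
  rw [hΓ, hΔ, Set.forall_mem_image2]
  simp only [Formula.realize_sup]
  constructor
  · rintro (h | h) ψ hψ χ hχ
    · exact Or.inl (h ψ hψ)
    · exact Or.inr (h χ hχ)
  · intro h
    by_contra! hn
    obtain ⟨⟨ψ, hψ, h1⟩, χ, hχ, h2⟩ := hn
    exact (h ψ hψ χ hχ).elim h1 h2

lemma isTypeDef_relE {f g : N → N → N} (hf : IsTermFun B f) (hg : IsTermFun B g) :
    IsTypeDef B fun x y => relE (f x y) (g x y) :=
  IsTypeDef.all fun r => (isTypeDef_R hf hg r).or (isTypeDef_R hg hf r)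

lemma isTypeDef_relEA {A : Set N} (hA : A ⊆ B) {f g : N → N → N} (hf : IsTermFun B f)
    (hg : IsTermFun B g) : IsTypeDef B fun x y => relEA A (f x y) (g x y) :=
  IsTypeDef.all fun _ => IsTypeDef.all fun ha => IsTypeDef.all fun n => IsTypeDef.all fun _ =>
    (isTypeDef_R ((hf.sub hg).nmul n) (isTermFun_const (hA ha)) 1).and
      (isTypeDef_R ((hg.sub hf).nmul n) (isTermFun_const (hA ha)) 1)

lemma IsTypeDef.isRelTypeDefinable {κ : Cardinal.{u}} {C : Set N} (hB : B ⊆ C) (hBκ : #B < κ)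
    {G : N → N → Prop} (hG : IsTypeDef B G) {X : Set N} {F : X → X → Prop}
    (hF : ∀ x y, F x y ↔ G x y) : IsRelTypeDefinable (L := lang) κ C F := by
  obtain ⟨Γ, hΓ⟩ := hG
  refine ⟨B, hB, hBκ, BoundedFormula.constantsVarsEquiv ⁻¹' Γ, fun x y => ?_⟩
  rw [hF, hΓ, ← BoundedFormula.constantsVarsEquiv.forall_congr_right]
  refine forall₂_congr fun φ _ => ?_
  rw [Formula.Realize, Formula.Realize, ← BoundedFormula.realize_constantsVarsEquiv]
  rfl

end TypeDefinable

/-! ### Equivalence relations from subgroups and reflections -/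

section Equivalences

variable {G : Type*} [AddCommGroup G] (H : AddSubgroup G) {X : Set G}

lemma equivalence_sub_mem : Equivalence fun x y : X => (x : G) - y ∈ H where
  refl x := by rw [sub_self]; exact H.zero_mem
  symm {x y} h := by rw [← neg_sub]; exact H.neg_mem h
  trans {x y z} h h' := by rw [← sub_add_sub_cancel _ (y : G)]; exact H.add_mem h h'

lemma equivalence_sub_mem_or (c : G) :
    Equivalence fun x y : X => (x : G) - y ∈ H ∨ (x : G) + y - c ∈ H where
  refl x := Or.inl (by rw [sub_self]; exact H.zero_mem)
  symm {x y} h := h.imp (fun h => by rw [← neg_sub]; exact H.neg_mem h)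
    (fun h => by rwa [add_comm])
  trans {x y z} h h' := by
    rcases h with h | h <;> rcases h' with h' | h'
    · left; convert H.add_mem h h' using 1; abel
    · right; convert H.add_mem h h' using 1; abel
    · right; convert H.sub_mem h h' using 1; abel
    · left; convert H.sub_mem h h' using 1; abel

end Equivalences

/-! ### Subgroups of infinitesimals -/

section Subgroups

variable {N : Type u} [lang.Structure N] [hN : N ⊨ theory]

variable (N) in
/-- The group of infinitesimals. -/
def infinitesimals : AddSubgroup N where
  carrier := {x | relE x 0}
  zero_mem' r := Or.inl ((R_iff _ _ _).2 ⟨le_rfl, by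
    rw [zero_add]; exact smul_nonneg r.2.le one_nonneg⟩)
  add_mem' := relE_zero_add
  neg_mem' := relE_zero_neg

lemma mem_infinitesimals {x y : N} : x - y ∈ infinitesimals N ↔ relE x y := relE_iff_sub.symm

/-- The group of elements which are infinitely smaller than all elements of `A`. -/
def infinitesimalsBelow (A : Set N) (hA : ∀ a ∈ A, IsPosInfinitesimal a) : AddSubgroup N where
  carrier := {x | relEA A x 0}
  zero_mem' := (relEA_iff hA).2 fun a ha n _ => by
    rw [sub_zero, smul_zero]
    exact ⟨(isPosInfinitesimal_iff.1 (hA a ha)).1.le, (isPosInfinitesimal_iff.1 (hA a ha)).1.le⟩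
  neg_mem' {x} hx := (relEA_iff hA).2 fun a ha n hn => by
    have := (relEA_iff hA).1 hx a ha n hn
    rw [sub_zero, zero_sub] at this ⊢
    rw [neg_neg]
    exact this.symm
  add_mem' {x y} hx hy := (relEA_iff hA).2 fun a ha n hn => by
    -- The hypotheses are used at `2 n`, so that each summand contributes at most half of `a`.
    have h1 := (relEA_iff hA).1 hx a ha (2 * n) (by positivity)
    have h2 := (relEA_iff hA).1 hy a ha (2 * n) (by positivity)
    rw [← Nat.cast_smul_eq_nsmul ℚ, ← Nat.cast_smul_eq_nsmul ℚ] at h1 h2 ⊢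
    push_cast at h1 h2
    constructor
    · linear_combination (norm := exact le_of_eq (by module))
        (1 / 2 : ℚ) • h1.1 + (1 / 2 : ℚ) • h2.1
    · linear_combination (norm := exact le_of_eq (by module))
        (1 / 2 : ℚ) • h1.2 + (1 / 2 : ℚ) • h2.2

lemma mem_infinitesimalsBelow {A : Set N} {hA : ∀ a ∈ A, IsPosInfinitesimal a} {x y : N} :
    x - y ∈ infinitesimalsBelow A hA ↔ relEA A x y := relEA_iff_sub.symm

end Subgroups

/-! ### The classification and its converse -/

section Main

variable {N : Type u} [lang.Structure N] [hN : N ⊨ theory]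

/-- The cut of `d` over the small space `U` is realized in `C` by saturation: between the two sides
of the cut if `d` is near `U`, and far from `U` otherwise. -/
lemma exists_same_cut {κ : Cardinal.{u}} {C : lang.ElementarySubstructure N} (hκ : ℵ₀ ≤ κ)
    (hC : IsSaturated lang C κ) {U : Submodule ℚ N} (h1 : one ∈ U) (hU : U ≤ subspace C)
    (hUκ : #U < κ) (d : N) :
    ∃ c ∈ C, ∀ u ∈ U, (u ≤ d ↔ u ≤ c) ∧ (d ≤ u ↔ c ≤ u) := by
  by_cases hd : d ∈ U
  · exact ⟨d, mem_subspace.1 (hU hd), fun _ _ => ⟨Iff.rfl, Iff.rfl⟩⟩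
  have small : ∀ P : N → Prop, #{x : C | (x : N) ∈ U ∧ P x} < κ := fun P => by
    refine lt_of_le_of_lt (mk_le_of_injective (f := fun x => (⟨x.1, x.2.1⟩ : U)) ?_) hUκ
    intro x y hxy
    exact Subtype.ext (Subtype.ext (congrArg (fun z : U => (z : N)) hxy))
  have hUC : ∀ u ∈ U, u ∈ C := fun u hu => mem_subspace.1 (hU hu)
  by_cases hn : ∃ u ∈ U, Near u d
  · obtain ⟨u₀, hu₀, hn⟩ := hn
    have hne : ∀ u ∈ U, u ≠ d := fun u hu h => hd (h ▸ hu)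
    have hlow : ∃ u ∈ U, u < d := by
      rcases hn with h | h
      · exact ⟨u₀, hu₀, lt_of_le_of_ne h (hne _ hu₀)⟩
      · obtain ⟨n, -, hn⟩ := exists_nat_bound h
        have hm : u₀ - n • one ∈ U := U.sub_mem hu₀ (U.smul_of_tower_mem n h1)
        exact ⟨_, hm, lt_of_le_of_ne (sub_le_iff_le_add.2 hn) (hne _ hm)⟩
    have hupp : ∃ u ∈ U, d < u := by
      rcases hn with h | h
      · obtain ⟨n, -, hn⟩ := exists_nat_bound h
        have hm : u₀ + n • one ∈ U := U.add_mem hu₀ (U.smul_of_tower_mem n h1)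
        exact ⟨_, hm, lt_of_le_of_ne hn (hne _ hm).symm⟩
      · exact ⟨u₀, hu₀, lt_of_le_of_ne h (hne _ hu₀).symm⟩
    obtain ⟨a, ha, had⟩ := hlow
    obtain ⟨b, hb, hbd⟩ := hupp
    obtain ⟨z, hz1, hz2⟩ := hC.exists_between hκ (small (· < d)) (small (d < ·))
      ⟨⟨a, hUC a ha⟩, ha, had⟩ ⟨⟨b, hUC b hb⟩, hb, hbd⟩
      (fun x hx y hy => coe_lt_coe_iff.1 (hx.2.trans hy.2))
    have hz1' : ∀ u ∈ U, u < d → u < z := fun u hu hud =>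
      coe_lt_coe_iff.2 (hz1 ⟨u, hUC u hu⟩ ⟨hu, hud⟩)
    have hz2' : ∀ u ∈ U, d < u → z < u := fun u hu hud =>
      coe_lt_coe_iff.2 (hz2 ⟨u, hUC u hu⟩ ⟨hu, hud⟩)
    have hzd : Near (z : N) d := (Near.of_ge (hz1' a ha had).le).trans (Near.of_le had.le)
    refine ⟨z, z.2, fun u hu =>
      ⟨⟨fun h => (hz1' u hu (lt_of_le_of_ne h (hne u hu))).le, fun h => ?_⟩,
      ⟨fun h => (hz2' u hu (lt_of_le_of_ne h (hne u hu).symm)).le, fun h => ?_⟩⟩⟩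
    · exact ((Near.of_le h).trans hzd).resolve_right fun h' =>
        (hz2' u hu (lt_of_le_of_ne h' (hne u hu).symm)).not_ge h
    · exact ((Near.of_ge h).trans hzd).resolve_left fun h' =>
        (hz1' u hu (lt_of_le_of_ne h' (hne u hu))).not_ge h
  · push Not at hn
    obtain ⟨z, hz⟩ := hC.exists_not_near (small fun _ => True)
    have hz' : ∀ u ∈ U, ¬ Near u z := fun u hu h =>
      hz ⟨u, hUC u hu⟩ ⟨hu, trivial⟩ (near_coe.1 h)
    exact ⟨z, z.2, fun u hu =>
      ⟨iff_of_false (fun h => hn u hu (Or.inl h)) (fun h => hz' u hu (Or.inl h)),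
        iff_of_false (fun h => hn u hu (Or.inr h)) (fun h => hz' u hu (Or.inr h))⟩⟩

/-- A relatively type-definable equivalence relation is one of the relations in the list. -/
theorem eq_of_isRelTypeDefinable {κ κ' : Cardinal.{u}} {C : lang.ElementarySubstructure N}
    (hκ₀ : ℵ₀ < κ)
    (hC : IsSaturated lang C κ) (hκ' : ℵ₀ < κ') (hCκ' : #C < κ') (hN' : IsSaturated lang N κ')
    {X : Set N} (hX : ∀ x, x ∈ X ↔ x ∉ subspace C ⊔ bdd N) {F : X → X → Prop}
    (hF : Equivalence F) (hdef : IsRelTypeDefinable (L := lang) κ (C : Set N) F) :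
    (∀ x y, F x y) ∨ (∀ x y, F x y ↔ x = y) ∨ (∀ x y, F x y ↔ relE (x : N) y) ∨
      (∃ c ∈ C, ∀ x y, F x y ↔ relEc c (x : N) y) ∨
      (∃ c ∈ C, ∀ x y, F x y ↔ relEcμ c (x : N) y) ∨
      (∃ A : Set N, A ⊆ C ∧ A.Nonempty ∧ #A < κ ∧ (∀ a ∈ A, IsPosInfinitesimal a) ∧
        ∀ x y, F x y ↔ relEA A (x : N) y) ∨
      (∃ A : Set N, A ⊆ C ∧ A.Nonempty ∧ #A < κ ∧ (∀ a ∈ A, IsPosInfinitesimal a) ∧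
        ∃ c ∈ C, ∀ x y, F x y ↔ relEAc A c (x : N) y) := by
  obtain ⟨B, hBC, hBκ, Γ, hΓ⟩ := hdef
  have hUκ : #(Submodule.span ℚ (insert one B)) < κ := by
    refine mk_span_lt hκ₀ (mk_insert_le.trans_lt (add_lt_of_lt hκ₀.le hBκ ?_))
    exact one_lt_aleph0.trans hκ₀
  let D : RelData N κ' :=
    { sat := hN'
      aleph0_lt := hκ'
      V := subspace C
      U := Submodule.span ℚ (insert one B)
      one_mem := Submodule.subset_span (Set.mem_insert _ _)
      U_le := by
        rw [Submodule.span_le]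
        rintro b (rfl | hb)
        · exact one_mem_subspace
        · exact mem_subspace.2 (hBC hb)
      mk_V := by rwa [mk_subspace]
      B := B
      B_sub := fun b hb => Submodule.subset_span (Set.mem_insert_of_mem _ hb)
      π := Γ
      refl := fun x hx => (hΓ ⟨x, (hX x).2 hx⟩ ⟨x, (hX x).2 hx⟩).1 (hF.refl _)
      symm := fun x hx y hy h => (hΓ ⟨y, (hX y).2 hy⟩ ⟨x, (hX x).2 hx⟩).1 (hF.symm
        ((hΓ ⟨x, (hX x).2 hx⟩ ⟨y, (hX y).2 hy⟩).2 h))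
      trans := fun x hx y hy z hz h h' => (hΓ ⟨x, (hX x).2 hx⟩ ⟨z, (hX z).2 hz⟩).1 (hF.trans
        ((hΓ ⟨x, (hX x).2 hx⟩ ⟨y, (hX y).2 hy⟩).2 h)
        ((hΓ ⟨y, (hX y).2 hy⟩ ⟨z, (hX z).2 hz⟩).2 h')) }
  have hFD : ∀ x y : X, F x y ↔ D.Holds x y := hΓ
  have hW : ∀ x : X, (x : N) ∉ D.W := fun x => (hX x).1 x.2
  have hUC : ∀ A : Set N, A ⊆ D.U → A ⊆ C ∧ #A < κ := fun A hA =>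
    ⟨fun a ha => mem_subspace.1 (D.U_le (hA ha)), (mk_le_mk_of_subset hA).trans_lt hUκ⟩
  by_cases hT : D.IsTotal
  · exact Or.inl fun x y => (hFD x y).2 (hT _ (hW x) _ (hW y))
  right
  have hcut : ∀ d ∈ D.W, ∃ c ∈ D.V, ∀ u ∈ D.U, (u ≤ d ↔ u ≤ c) ∧ (d ≤ u ↔ c ≤ u) := fun d _ => by
    obtain ⟨c, hc, h⟩ := exists_same_cut hκ₀.le hC D.one_mem D.U_le hUκ d
    exact ⟨c, mem_subspace.2 hc, h⟩
  rcases (RelData.classification hcut).resolve_left hT with h | ⟨c, hc, h⟩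
  · have h' : ∀ x y : X, F x y ↔ (x : N) - y ∈ D.H := fun x y =>
      (hFD x y).trans (h _ (hW x) _ (hW y))
    rcases RelData.H_classification hT with hH | hH | ⟨A, hAU, hA, hAinf, hH⟩
    · left
      exact fun x y => by rw [h', hH, sub_eq_zero, Subtype.ext_iff]
    · right; left
      exact fun x y => by rw [h', hH, ← relE_iff_sub]
    · right; right; right; right; left
      exact ⟨A, (hUC A hAU).1, hA, (hUC A hAU).2, hAinf, fun x y => by
        rw [h', hH, ← relEA_iff_sub]⟩
  · have hc' : c ∈ C := mem_subspace.1 hc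
    have h' : ∀ x y : X, F x y ↔ (x : N) - y ∈ D.H ∨ (x : N) + y - c ∈ D.H := fun x y =>
      (hFD x y).trans (h _ (hW x) _ (hW y))
    right; right
    rcases RelData.H_classification hT with hH | hH | ⟨A, hAU, hA, hAinf, hH⟩
    · left
      exact ⟨c, hc', fun x y => by
        rw [h', hH, hH, sub_eq_zero, sub_eq_zero, relEc, add_eq]⟩
    · right; left
      exact ⟨c, hc', fun x y => by
        rw [h', hH, hH, ← relE_iff_sub, ← relE_iff_sub, relEcμ, add_eq]⟩
    · right; right; right
      exact ⟨A, (hUC A hAU).1, hA, (hUC A hAU).2, hAinf, c, hc', fun x y => by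
        rw [h', hH, hH, ← relEA_iff_sub, ← relEA_iff_sub, relEAc, add_eq]⟩

/-- The relations in the list are relatively type-definable equivalence relations. -/
theorem equivalence_and_isRelTypeDefinable {κ : Cardinal.{u}} {C X : Set N} (hκ₀ : ℵ₀ < κ)
    {F : X → X → Prop}
    (h : (∀ x y, F x y) ∨ (∀ x y, F x y ↔ x = y) ∨ (∀ x y, F x y ↔ relE (x : N) y) ∨
      (∃ c ∈ C, ∀ x y, F x y ↔ relEc c (x : N) y) ∨
      (∃ c ∈ C, ∀ x y, F x y ↔ relEcμ c (x : N) y) ∨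
      (∃ A : Set N, A ⊆ C ∧ A.Nonempty ∧ #A < κ ∧ (∀ a ∈ A, IsPosInfinitesimal a) ∧
        ∀ x y, F x y ↔ relEA A (x : N) y) ∨
      (∃ A : Set N, A ⊆ C ∧ A.Nonempty ∧ #A < κ ∧ (∀ a ∈ A, IsPosInfinitesimal a) ∧
        ∃ c ∈ C, ∀ x y, F x y ↔ relEAc A c (x : N) y)) :
    Equivalence F ∧ IsRelTypeDefinable (L := lang) κ C F := by
  have hone : (1 : Cardinal.{u}) < κ := one_lt_aleph0.trans hκ₀
  have hempty : #(∅ : Set N) < κ := by rw [mk_eq_zero]; exact zero_lt_one.trans hone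
  have hsing : ∀ c : N, #({c} : Set N) < κ := fun c => by rwa [mk_singleton]
  have equiv_sub : ∀ H : AddSubgroup N, (∀ x y, F x y ↔ (x : N) - y ∈ H) → Equivalence F :=
    fun H hH => by
      have : F = fun x y : X => (x : N) - y ∈ H := funext₂ fun x y => propext (hH x y)
      rw [this]
      exact equivalence_sub_mem H
  have equiv_or : ∀ (H : AddSubgroup N) (c : N),
      (∀ x y, F x y ↔ (x : N) - y ∈ H ∨ (x : N) + y - c ∈ H) → Equivalence F :=
    fun H c hH => by
      have : F = fun x y : X => (x : N) - y ∈ H ∨ (x : N) + y - c ∈ H :=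
        funext₂ fun x y => propext (hH x y)
      rw [this]
      exact equivalence_sub_mem_or H c
  rcases h with h | h | h | ⟨c, hc, h⟩ | ⟨c, hc, h⟩ | ⟨A, hAC, -, hAκ, hA, h⟩ |
    ⟨A, hAC, -, hAκ, hA, c, hc, h⟩
  · refine ⟨equiv_sub ⊤ fun x y => iff_of_true (h x y) (AddSubgroup.mem_top _), ?_⟩
    exact IsTypeDef.isRelTypeDefinable (Set.empty_subset C) hempty
      (isTypeDef_eq isTermFun_fst isTermFun_fst) fun x y => iff_of_true (h x y) rfl
  · refine ⟨equiv_sub ⊥ fun x y => by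
      rw [h, AddSubgroup.mem_bot, sub_eq_zero, Subtype.ext_iff], ?_⟩
    exact IsTypeDef.isRelTypeDefinable (Set.empty_subset C) hempty
      (isTypeDef_eq isTermFun_fst isTermFun_snd) fun x y => by rw [h, Subtype.ext_iff]
  · refine ⟨equiv_sub (infinitesimals N) fun x y => by rw [h, mem_infinitesimals], ?_⟩
    exact IsTypeDef.isRelTypeDefinable (Set.empty_subset C) hempty
      (isTypeDef_relE isTermFun_fst isTermFun_snd) h
  · refine ⟨equiv_or ⊥ c fun x y => by
      rw [h, AddSubgroup.mem_bot, AddSubgroup.mem_bot, sub_eq_zero, sub_eq_zero, relEc, add_eq], ?_⟩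
    exact IsTypeDef.isRelTypeDefinable (Set.singleton_subset_iff.2 hc) (hsing c)
      ((isTypeDef_eq isTermFun_fst isTermFun_snd).or (isTypeDef_eq
        (isTermFun_fst.add isTermFun_snd) (isTermFun_const (Set.mem_singleton c)))) h
  · refine ⟨equiv_or (infinitesimals N) c fun x y => by
      rw [h, mem_infinitesimals, mem_infinitesimals, relEcμ, add_eq], ?_⟩
    exact IsTypeDef.isRelTypeDefinable (Set.singleton_subset_iff.2 hc) (hsing c)
      ((isTypeDef_relE isTermFun_fst isTermFun_snd).or (isTypeDef_relE
        (isTermFun_fst.add isTermFun_snd) (isTermFun_const (Set.mem_singleton c)))) h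
  · refine ⟨equiv_sub (infinitesimalsBelow A hA) fun x y => by
      rw [h, mem_infinitesimalsBelow], ?_⟩
    exact IsTypeDef.isRelTypeDefinable hAC hAκ
      (isTypeDef_relEA subset_rfl isTermFun_fst isTermFun_snd) h
  · refine ⟨equiv_or (infinitesimalsBelow A hA) c fun x y => by
      rw [h, mem_infinitesimalsBelow, mem_infinitesimalsBelow, relEAc, add_eq], ?_⟩
    exact IsTypeDef.isRelTypeDefinable (Set.insert_subset hc hAC)
      (mk_insert_le.trans_lt (add_lt_of_lt hκ₀.le hAκ hone))
      ((isTypeDef_relEA (Set.subset_insert c A) isTermFun_fst isTermFun_snd).or (isTypeDef_relEA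
        (Set.subset_insert c A) (isTermFun_fst.add isTermFun_snd)
        (isTermFun_const (Set.mem_insert c A)))) h

end Main

end LocalOrder

theorem mainTheorem8 (κ κ' : Cardinal.{u})
    (N : Type u) [LocalOrder.lang.Structure N] (hN : N ⊨ LocalOrder.theory)
    (C : LocalOrder.lang.ElementarySubstructure N)
    (hκ : κ.IsStrongLimit) (hκ₀ : ℵ₀ < κ)
    (hC : LocalOrder.IsSaturated LocalOrder.lang C κ)
    (hκ' : κ'.IsStrongLimit) (hCκ' : #C < κ')
    (hNsat : LocalOrder.IsSaturated LocalOrder.lang N κ')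
    (hNhom : LocalOrder.IsStronglyHomogeneous LocalOrder.lang N κ') :
    ∃ p : LocalOrder.TypeOver LocalOrder.lang (C : Set N),
      (∀ q : LocalOrder.TypeOver LocalOrder.lang (C : Set N),
        LocalOrder.SaysUnrelated q ↔ q = p) ∧
      ∀ F : p.realizations → p.realizations → Prop,
        (Equivalence F ∧
          LocalOrder.IsRelTypeDefinable (L := LocalOrder.lang) κ (C : Set N) F) ↔
        ((∀ x y, F x y) ∨
          (∀ x y, F x y ↔ x = y) ∨
          (∀ x y, F x y ↔ LocalOrder.relE (x : N) y) ∨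
          (∃ c ∈ C, ∀ x y, F x y ↔ LocalOrder.relEc c (x : N) y) ∨
          (∃ c ∈ C, ∀ x y, F x y ↔ LocalOrder.relEcμ c (x : N) y) ∨
          (∃ A : Set N, A ⊆ C ∧ A.Nonempty ∧ #A < κ ∧
            (∀ a ∈ A, LocalOrder.IsPosInfinitesimal a) ∧
            ∀ x y, F x y ↔ LocalOrder.relEA A (x : N) y) ∨
          (∃ A : Set N, A ⊆ C ∧ A.Nonempty ∧ #A < κ ∧
            (∀ a ∈ A, LocalOrder.IsPosInfinitesimal a) ∧
            ∃ c ∈ C, ∀ x y, F x y ↔ LocalOrder.relEAc A c (x : N) y)) := by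
  -- The multiples of `1` are distinct, so `C` is infinite and `#C < κ'` forces `κ'` to be
  -- uncountable.
  have hκ₁ : ℵ₀ < κ' := by
    refine lt_of_not_ge fun h => ?_
    have hfin : #C < ℵ₀ := hCκ'.trans_le h
    have : Finite C := lt_aleph0_iff_finite.1 hfin
    have hinj : Function.Injective fun n : ℕ => n • (LocalOrder.one : C) := fun m n hmn => by
      have h1 : ((m : ℚ) - n) • (LocalOrder.one : C) = 0 := by
        rw [sub_smul, Nat.cast_smul_eq_nsmul, Nat.cast_smul_eq_nsmul, sub_eq_zero]
        exact hmn
      have h2 := (smul_eq_zero.1 h1).resolve_right LocalOrder.one_elt_ne_zero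
      exact_mod_cast sub_eq_zero.1 h2
    exact not_finite_iff_infinite.2 (Infinite.of_injective _ hinj) this
  obtain ⟨p, hp, hp'⟩ := LocalOrder.exists_unique_type hκ₁ hCκ' hNsat
  refine ⟨p, hp, fun F => ⟨fun h => ?_, LocalOrder.equivalence_and_isRelTypeDefinable hκ₀⟩⟩
  refine LocalOrder.eq_of_isRelTypeDefinable hκ₀ hC hκ₁ hCκ' hNsat (fun x => ?_) h.1 h.2
  rw [hp', LocalOrder.mem_sup_bdd]
  simp only [LocalOrder.mem_subspace, not_exists, not_and]
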